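/- Let $n\ge 4$ and work over $\mathbb C$. Let $(a^0_{i,j})_{0\le i,j\le n}$ be the Cartan matrix of type $D_n^{(1)}$, i.e. of $\widehat{\mathfrak{so}}(2n)$ (edges of the Dynkin diagram: $0-2$; $k-(k+1)$ for $1\le k\le n-2$; $(n-2)-n$). For $1\le i\le n-1$, $0\le j\le n$ put $a^1_{i,j}=a^0_{i,j}$, except that $a^1_{1,0}=a^1_{n-1,n}=2$; put $a^{2r}_{i,j}=a^0_{i,j}$ and $a^{2r+1}_{i,j}=a^1_{i,j}$. Call $(0,1),(1,0),(n-1,n),(n,n-1)$ the fork pairs. Write $\delta_{m,\mathrm{odd}}=1$ if $m$ is odd and $0$ otherwise. Given elements $x_i^{\pm}$ $(0\le i\le n)$ of a Lie algebra, let $\theta^{\pm}=(-1)^n\,\mathrm{ad}x^\pm_2\,\mathrm{ad}x^\pm_3\cdots\mathrm{ad}x^\pm_{n-2}\,\mathrm{ad}x^\pm_n\,\mathrm{ad}x^\pm_{n-1}\,\mathrm{ad}x^\pm_{n-2}\cdots\mathrm{ad}x^\pm_2(x^\pm_0)$, $\eta_+=[x_1^+,\theta^+]$, $\eta_-=[\theta^-,x_1^-]$,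 and for $u\in\mathbb Z$ let $T_u=\big[(\tfrac12\mathrm{ad}\,\eta_{\pm})^{|u|}(x_1^+),\,x_1^-\big]$, with $\eta_+$ if $u\ge0$ and $\eta_-$ if $u<0$. (For the Chevalley generators of $\widehat{\mathfrak{so}}(2n)$ given by $x^+_i=f_{i,i+1}$, $x^-_i=f_{i+1,i}$ for $1\le i\le n-1$, $x_n^+=f_{n-1,-n}$, $x_n^-=f_{-n,n-1}$, $x_0^+=f_{-2,1}t$, $x_0^-=f_{1,-2}t^{-1}$, where $f_{i,j}=E_{i,j}-E_{-j,-i}$, this is $T_u=(f_{1,1}-f_{2,2})t^u$.) The Lie algebra $D(2n)$ is generated by $H_{i,r}$ ($1\le i\le n-1$, $r\ge0$), $H_{0,2r},H_{n,2r}$ ($r\ge0$), $X^\pm_{i,r}$ ($0\le i\le n$, $r\ge0$) and $X^\pm_{-1,2r+1},X^\pm_{n+1,2r+1}$ ($r\ge 0$), subject to the following relations, for all indices for which the generators on the left-hand sides exist. - $[H_{i,r},H_{j,s}]=0$, and $[H_{i,r},X^\pm_{j,s}]=\pm a^r_{i,j}X^\pm_{j,r+s}$ for $0\le j\le n$. -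 For $0\le i\le n$: $[X^+_{i,r},X^-_{i,s}]=H_{i,r+s}$, except that for odd $r+s$ it is $H_{1,r+s}$ if $i=0$ and $H_{n-1,r+s}$ if $i=n$. For $0\le i\ne j\le n$ not a fork pair, $[X^+_{i,r},X^-_{j,s}]=0$. - $[X^+_{n-1,r},X^-_{n,s}]=-\delta_{r+s,\mathrm{odd}}X^-_{n+1,r+s}$, $[X^+_{n,r},X^-_{n-1,s}]=-\delta_{r+s,\mathrm{odd}}X^+_{n+1,r+s}$, $[X^+_{0,r},X^-_{1,s}]=-\delta_{r+s,\mathrm{odd}}X^+_{-1,r+s}$, $[X^+_{1,r},X^-_{0,s}]=-\delta_{r+s,\mathrm{odd}}X^-_{-1,r+s}$. - For all sign choices, $[X^{\pm}_{i,r},X^{+}_{n+1,s}]=[X^{\pm}_{i,r},X^{-}_{n+1,s}]=0$ if $1\le i\le n-2$, and $[X^{\pm}_{i,r},X^{+}_{-1,s}]=[X^{\pm}_{i,r},X^{-}_{-1,s}]=0$ if $2\le i\le n+1$. - $[X^+_{n-1,r},X^+_{n+1,s}]=2X^+_{n,r+s}$, $[X^-_{n-1,r},X^+_{n+1,s}]=0$,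 $[X^+_{n-1,r},X^-_{n+1,s}]=0$, $[X^-_{n-1,r},X^-_{n+1,s}]=-2X^-_{n,r+s}$. - $[X^+_{n,r},X^+_{n+1,s}]=0$, $[X^-_{n,r},X^+_{n+1,s}]=-2X^-_{n-1,r+s}$, $[X^+_{n,r},X^-_{n+1,s}]=2X^+_{n-1,r+s}$, $[X^-_{n,r},X^-_{n+1,s}]=0$. - $[X^+_{0,r},X^+_{-1,s}]=0$, $[X^-_{0,r},X^+_{-1,s}]=-2X^-_{1,r+s}$, $[X^+_{0,r},X^-_{-1,s}]=2X^+_{1,r+s}$, $[X^-_{0,r},X^-_{-1,s}]=0$. - $[X^+_{1,r},X^+_{-1,s}]=2X^+_{0,r+s}$, $[X^-_{1,r},X^+_{-1,s}]=0$, $[X^+_{1,r},X^-_{-1,s}]=0$, $[X^-_{1,r},X^-_{-1,s}]=-2X^-_{0,r+s}$. - $[X^\pm_{i,r},X^\pm_{i,s}]=0$ for $-1\le i\le n+1$. - For $0\le i\le j\le n$: $[X^\pm_{i,r+1},X^\pm_{j,s}]=\epsilon\,[X^\pm_{i,r},X^\pm_{j,s+1}]$ with $\epsilon=-1$ if $(i,j)\in\{(0,1),(n-1,n)\}$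 and $\epsilon=1$ otherwise. - For $0\le i\neq j\le n$ with $a^0_{i,j}=0$: $[X^\pm_{i,r},X^\pm_{j,s}]=0$, where for fork pairs this is imposed only if $r+s$ is even. If $a^0_{i,j}=-1$: $[X^\pm_{i,r},[X^\pm_{i,s},X^\pm_{j,u}]]=0$. For fork pairs: $[X^\pm_{i,0},[X^\pm_{i,0},X^\pm_{j,2r+1}]]=0$. - $[X^+_{1,1},[X^-_{1,0},T_u]]-[X^+_{1,0},[X^-_{1,1},T_u]]=0$ for all $u\in\mathbb Z$, with $T_u$ formed from $x_i^\pm=X^\pm_{i,0}$. The associative algebra $\widetilde D(2n)$ is generated by $h_{i,0}$ ($0\le i\le n$), $h_{i,1}$ ($1\le i\le n-1$) and $x^\pm_{i,0},x^\pm_{i,1}$ ($0\le i\le n$), subject to the following relations (brackets are commutators; $0\le i,j\le n$ unless restricted). - $[h_{i,r},h_{j,s}]=0$, and $[h_{i,r},x^\pm_{j,0}]=\pm a^r_{i,j}x^\pm_{j,r}$ for $r\in\{0,1\}$. - $[x^+_{i,0},x^-_{j,0}]=\delta_{i,j}h_{i,0}$; $[x^+_{i,1},x^-_{i,0}]=h_{i,1}$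 for $1\le i\le n-1$; $[x^+_{n,1},x^-_{n,0}]=h_{n-1,1}$; $[x^+_{0,1},x^-_{0,0}]=h_{1,1}$. - $[x^\pm_{i,1},x^\pm_{i,0}]=0$; $[x^\pm_{i,0},x^\pm_{j,0}]=0$ if $a^0_{i,j}=0$; $[x^\pm_{i,0},[x^\pm_{i,0},x^\pm_{j,0}]]=0$ if $a^0_{i,j}=-1$. - $[[x^+_{n-1,1},x^-_{n-1,1}],x^\pm_{n,0}]=0$ and $[[x^+_{0,1},x^-_{0,1}],x^\pm_{1,0}]=0$. - $[x^+_{1,1},[x^-_{1,0},T_u]]-[x^+_{1,0},[x^-_{1,1},T_u]]=0$ for all $u\in\mathbb Z$, with $T_u$ formed from $x_i^\pm=x^\pm_{i,0}$. Theorem. There is an isomorphism of associative algebras $\widetilde D(2n)\cong U(D(2n))$ onto the universal enveloping algebra of $D(2n)$ with $h_{i,r}\mapsto H_{i,r}$ and $x^\pm_{i,r}\mapsto X^\pm_{i,r}$ for all generators of $\widetilde D(2n)$. Moreover, the Lie algebra $D(2n)$ is generated by the elements $H_{i,0},X^\pm_{i,0},X^\pm_{i,1}$ ($0\le i\le n$)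 and $H_{i,1}$ ($1\le i\le n-1$). -/

import Mathlib

/-! Twisted toroidal Lie algebra `D(2n)` of type `D`, and the associative algebra given by the
minimalistic presentation.  Indices `i` of generators are integers between `-1` and `n + 1`. -/

namespace TwistedD

/-- The two signs in superscripts `±`. -/
inductive Sgn : Type
  | pos : Sgn
  | neg : Sgn

/-- The integer `±1` attached to a sign. -/
def Sgn.toInt : Sgn → ℤ
  | .pos => 1
  | .neg => -1

/-- The Cartan matrix of the affine Lie algebra of `so(2n)` (type `D_n^{(1)}`, nodes `0, …, n`):
the edges of its Dynkin diagram are `0 — 2`, `k — k+1` for `1 ≤ k ≤ n-2`, and `n-2 — n`. -/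
def cartanEven (n : ℕ) (i j : ℤ) : ℤ :=
  if i = j then 2
  else if (i = 0 ∧ j = 2) ∨ (1 ≤ i ∧ j = i + 1 ∧ j ≤ (n : ℤ) - 1) ∨ (i = (n : ℤ) - 2 ∧ j = n) ∨
      (j = 0 ∧ i = 2) ∨ (1 ≤ j ∧ i = j + 1 ∧ i ≤ (n : ℤ) - 1) ∨ (j = (n : ℤ) - 2 ∧ i = n) then -1
  else 0

/-- The matrix used in odd degree (rows `1 ≤ i ≤ n-1`): it differs from the Cartan matrix only
in the entries `(1, 0)` and `(n-1, n)`, which are `2`. -/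
def cartanOdd (n : ℕ) (i j : ℤ) : ℤ :=
  if (i = 1 ∧ j = 0) ∨ (i = (n : ℤ) - 1 ∧ j = n) then 2 else cartanEven n i j

/-- The numbers `a^r_{i,j}`. -/
def cartan (n r : ℕ) (i j : ℤ) : ℤ :=
  if Even r then cartanEven n i j else cartanOdd n i j

/-- The ordered pairs `(0,1), (1,0), (n-1,n), (n,n-1)`. -/
def IsFork (n : ℕ) (i j : ℤ) : Prop :=
  (i = 0 ∧ j = 1) ∨ (i = 1 ∧ j = 0) ∨ (i = (n : ℤ) - 1 ∧ j = n) ∨ (i = n ∧ j = (n : ℤ) - 1)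

section LoopElement

variable {L : Type} [AddCommGroup L] [Bracket L L] [Module ℂ L]

/-- The sequence of nodes `2, 3, …, n-2, n, n-1, n-2, …, 3, 2`. -/
def rootWord (n : ℕ) : List ℤ :=
  (List.range' 2 (n - 3) ++ [n] ++ (List.range' 2 (n - 2)).reverse).map fun k => (k : ℤ)

/-- `(-1)^n [x_2,[x_3,…[x_{n-2},[x_n,[x_{n-1},[x_{n-2},…[x_2,x_0]…]]]]…]]`.
Write `f_{i,j} = E_{i,j} - E_{-j,-i}`.  On the Chevalley generators
`x_i^+ = f_{i,i+1}` (`1 ≤ i ≤ n-1`), `x_n^+ = f_{n-1,-n}`, `x_0^+ = f_{-2,1} t` of the affine Lie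
algebra of `so(2n)` this is `f_{2,1} t`; on the generators `x_i^- = f_{i+1,i}`,
`x_n^- = f_{-n,n-1}`, `x_0^- = f_{1,-2} t^{-1}` it is `f_{1,2} t^{-1}`. -/
def rootVector (n : ℕ) (x : ℤ → L) : L :=
  ((-1 : ℤ) ^ n) • (rootWord n).foldr (fun i y => ⁅x i, y⁆) (x 0)

/-- `k ↦ (1/2 ad h)^k e`. -/
noncomputable def halfAdIter (h e : L) : ℕ → L
  | 0 => e
  | k + 1 => (1 / 2 : ℂ) • ⁅h, halfAdIter h e k⁆

/-- The element `(f_{1,1} - f_{2,2}) t^u` of the affine Lie algebra of `so(2n)`, expressed through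
its Chevalley generators `xp i = x_i^+` and `xm i = x_i^-`.  For `u ≥ 0` one has
`(f_{1,1} - f_{2,2}) t = [f_{1,2}, f_{2,1} t]`,
`f_{1,2} t^{k+1} = 1/2 [(f_{1,1} - f_{2,2}) t, f_{1,2} t^k]` and
`(f_{1,1} - f_{2,2}) t^u = [f_{1,2} t^u, f_{2,1}]`;
for `u < 0` use `(f_{1,1} - f_{2,2}) t^{-1} = [f_{1,2} t^{-1}, f_{2,1}]` instead. -/
noncomputable def loopCartan (n : ℕ) (xp xm : ℤ → L) (u : ℤ) : L :=
  ⁅halfAdIter (if 0 ≤ u then ⁅xp 1, rootVector n xp⁆ else ⁅rootVector n xm, xm 1⁆)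
    (xp 1) u.natAbs, xm 1⁆

end LoopElement

/-! ### The Lie algebra `D(2n)` -/

/-- Indices of the generators `H_{i,r}`: `1 ≤ i ≤ n-1` and any `r`, or `i ∈ {0, n}` and even `r`. -/
def ValidH (n : ℕ) (i : ℤ) (r : ℕ) : Prop :=
  (1 ≤ i ∧ i ≤ (n : ℤ) - 1) ∨ ((i = 0 ∨ i = n) ∧ Even r)

/-- Indices of the generators `X^±_{i,r}`: `0 ≤ i ≤ n` and any `r`, or `i ∈ {-1, n+1}` and
odd `r`. -/
def ValidX (n : ℕ) (i : ℤ) (r : ℕ) : Prop :=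
  (0 ≤ i ∧ i ≤ (n : ℤ)) ∨ ((i = -1 ∨ i = (n : ℤ) + 1) ∧ Odd r)

/-- The generators of `D(2n)`. -/
inductive DGen (n : ℕ) : Type
  | H (i : ℤ) (r : ℕ) (h : ValidH n i r) : DGen n
  | X (s : Sgn) (i : ℤ) (r : ℕ) (h : ValidX n i r) : DGen n

/-- The free Lie algebra on the generators of `D(2n)`. -/
abbrev DFree (n : ℕ) : Type := FreeLieAlgebra ℂ (DGen n)

open Classical in
/-- `H_{i,r}` in the free Lie algebra (`0` if there is no such generator). -/
noncomputable def DFree.H (n : ℕ) (i : ℤ) (r : ℕ) : DFree n :=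
  if h : ValidH n i r then FreeLieAlgebra.of ℂ (DGen.H i r h) else 0

open Classical in
/-- `X^±_{i,r}` in the free Lie algebra (`0` if there is no such generator). -/
noncomputable def DFree.X (n : ℕ) (s : Sgn) (i : ℤ) (r : ℕ) : DFree n :=
  if h : ValidX n i r then FreeLieAlgebra.of ℂ (DGen.X s i r h) else 0

/-- The value of `[X^+_{i,r}, X^-_{i,s}]` for `0 ≤ i ≤ n` and `m = r + s`: it is `H_{i,m}`, except
that it is `H_{1,m}` if `i = 0` and `m` is odd, and `H_{n-1,m}` if `i = n` and `m` is odd. -/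
noncomputable def DFree.coroot (n : ℕ) (i : ℤ) (m : ℕ) : DFree n :=
  if Even m then DFree.H n i m
  else if i = 0 then DFree.H n 1 m
  else if i = n then DFree.H n ((n : ℤ) - 1) m
  else DFree.H n i m

/-- `-δ_{m,odd} X^±_{i,m}` (for `i ∈ {-1, n+1}`). -/
noncomputable def DFree.negOdd (n : ℕ) (s : Sgn) (i : ℤ) (m : ℕ) : DFree n :=
  if Odd m then -DFree.X n s i m else 0

open DFree in
/-- The defining relations of `D(2n)`; `DRel n a b` is the relation `a = b`. -/
inductive DRel (n : ℕ) : DFree n → DFree n → Prop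
  | hh (i j : ℤ) (r s : ℕ) (hi : ValidH n i r) (hj : ValidH n j s) :
      DRel n ⁅H n i r, H n j s⁆ 0
  | hx (e : Sgn) (i j : ℤ) (r s : ℕ) (hi : ValidH n i r) (hj : 0 ≤ j ∧ j ≤ (n : ℤ)) :
      DRel n ⁅H n i r, X n e j s⁆ ((e.toInt * cartan n r i j) • X n e j (r + s))
  -- `[X^+, X^-]` for indices in `0, …, n`
  | xx_same (i : ℤ) (r s : ℕ) (hi : 0 ≤ i ∧ i ≤ (n : ℤ)) :
      DRel n ⁅X n .pos i r, X n .neg i s⁆ (coroot n i (r + s))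
  | xx_diff (i j : ℤ) (r s : ℕ) (hi : 0 ≤ i ∧ i ≤ (n : ℤ)) (hj : 0 ≤ j ∧ j ≤ (n : ℤ))
      (hij : i ≠ j) (hf : ¬ IsFork n i j) :
      DRel n ⁅X n .pos i r, X n .neg j s⁆ 0
  | xx_pred_last (r s : ℕ) :
      DRel n ⁅X n .pos ((n : ℤ) - 1) r, X n .neg n s⁆ (negOdd n .neg ((n : ℤ) + 1) (r + s))
  | xx_last_pred (r s : ℕ) :
      DRel n ⁅X n .pos n r, X n .neg ((n : ℤ) - 1) s⁆ (negOdd n .pos ((n : ℤ) + 1) (r + s))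
  | xx_zero_one (r s : ℕ) :
      DRel n ⁅X n .pos 0 r, X n .neg 1 s⁆ (negOdd n .pos (-1) (r + s))
  | xx_one_zero (r s : ℕ) :
      DRel n ⁅X n .pos 1 r, X n .neg 0 s⁆ (negOdd n .neg (-1) (r + s))
  -- brackets with the additional generators `X^±_{n+1,s}` and `X^±_{-1,s}`, `s` odd
  | end_far (e f : Sgn) (i : ℤ) (r s : ℕ) (hi : 1 ≤ i ∧ i ≤ (n : ℤ) - 2) (hs : Odd s) :
      DRel n ⁅X n e i r, X n f ((n : ℤ) + 1) s⁆ 0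
  | start_far (e f : Sgn) (i : ℤ) (r s : ℕ) (hi : 2 ≤ i ∧ i ≤ (n : ℤ) + 1) (hr : ValidX n i r)
      (hs : Odd s) :
      DRel n ⁅X n e i r, X n f (-1) s⁆ 0
  | end_pred_pp (r s : ℕ) (hs : Odd s) :
      DRel n ⁅X n .pos ((n : ℤ) - 1) r, X n .pos ((n : ℤ) + 1) s⁆ ((2 : ℤ) • X n .pos n (r + s))
  | end_pred_mp (r s : ℕ) (hs : Odd s) :
      DRel n ⁅X n .neg ((n : ℤ) - 1) r, X n .pos ((n : ℤ) + 1) s⁆ 0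
  | end_pred_pm (r s : ℕ) (hs : Odd s) :
      DRel n ⁅X n .pos ((n : ℤ) - 1) r, X n .neg ((n : ℤ) + 1) s⁆ 0
  | end_pred_mm (r s : ℕ) (hs : Odd s) :
      DRel n ⁅X n .neg ((n : ℤ) - 1) r, X n .neg ((n : ℤ) + 1) s⁆ ((-2 : ℤ) • X n .neg n (r + s))
  | end_last_pp (r s : ℕ) (hs : Odd s) :
      DRel n ⁅X n .pos n r, X n .pos ((n : ℤ) + 1) s⁆ 0
  | end_last_mp (r s : ℕ) (hs : Odd s) :
      DRel n ⁅X n .neg n r, X n .pos ((n : ℤ) + 1) s⁆ ((-2 : ℤ) • X n .neg ((n : ℤ) - 1) (r + s))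
  | end_last_pm (r s : ℕ) (hs : Odd s) :
      DRel n ⁅X n .pos n r, X n .neg ((n : ℤ) + 1) s⁆ ((2 : ℤ) • X n .pos ((n : ℤ) - 1) (r + s))
  | end_last_mm (r s : ℕ) (hs : Odd s) :
      DRel n ⁅X n .neg n r, X n .neg ((n : ℤ) + 1) s⁆ 0
  | start_zero_pp (r s : ℕ) (hs : Odd s) :
      DRel n ⁅X n .pos 0 r, X n .pos (-1) s⁆ 0
  | start_zero_mp (r s : ℕ) (hs : Odd s) :
      DRel n ⁅X n .neg 0 r, X n .pos (-1) s⁆ ((-2 : ℤ) • X n .neg 1 (r + s))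
  | start_zero_pm (r s : ℕ) (hs : Odd s) :
      DRel n ⁅X n .pos 0 r, X n .neg (-1) s⁆ ((2 : ℤ) • X n .pos 1 (r + s))
  | start_zero_mm (r s : ℕ) (hs : Odd s) :
      DRel n ⁅X n .neg 0 r, X n .neg (-1) s⁆ 0
  | start_one_pp (r s : ℕ) (hs : Odd s) :
      DRel n ⁅X n .pos 1 r, X n .pos (-1) s⁆ ((2 : ℤ) • X n .pos 0 (r + s))
  | start_one_mp (r s : ℕ) (hs : Odd s) :
      DRel n ⁅X n .neg 1 r, X n .pos (-1) s⁆ 0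
  | start_one_pm (r s : ℕ) (hs : Odd s) :
      DRel n ⁅X n .pos 1 r, X n .neg (-1) s⁆ 0
  | start_one_mm (r s : ℕ) (hs : Odd s) :
      DRel n ⁅X n .neg 1 r, X n .neg (-1) s⁆ ((-2 : ℤ) • X n .neg 0 (r + s))
  -- brackets of generators with equal signs, and Serre relations
  | same_node (e : Sgn) (i : ℤ) (r s : ℕ) (hr : ValidX n i r) (hs : ValidX n i s) :
      DRel n ⁅X n e i r, X n e i s⁆ 0
  | shift (e : Sgn) (i j : ℤ) (r s : ℕ) (hij : 0 ≤ i ∧ i ≤ j ∧ j ≤ (n : ℤ))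
      (hf : ¬ IsFork n i j) :
      DRel n ⁅X n e i (r + 1), X n e j s⁆ ⁅X n e i r, X n e j (s + 1)⁆
  | shift_zero_one (e : Sgn) (r s : ℕ) :
      DRel n ⁅X n e 0 (r + 1), X n e 1 s⁆ (-⁅X n e 0 r, X n e 1 (s + 1)⁆)
  | shift_pred_last (e : Sgn) (r s : ℕ) :
      DRel n ⁅X n e ((n : ℤ) - 1) (r + 1), X n e n s⁆ (-⁅X n e ((n : ℤ) - 1) r, X n e n (s + 1)⁆)
  | serre_two (e : Sgn) (i j : ℤ) (r s : ℕ) (hi : 0 ≤ i ∧ i ≤ (n : ℤ))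
      (hj : 0 ≤ j ∧ j ≤ (n : ℤ)) (hij : i ≠ j) (ha : cartan n 0 i j = 0)
      (hf : IsFork n i j → Even (r + s)) :
      DRel n ⁅X n e i r, X n e j s⁆ 0
  | serre_three (e : Sgn) (i j : ℤ) (r s u : ℕ) (hi : 0 ≤ i ∧ i ≤ (n : ℤ))
      (hj : 0 ≤ j ∧ j ≤ (n : ℤ)) (ha : cartan n 0 i j = -1) :
      DRel n ⁅X n e i r, ⁅X n e i s, X n e j u⁆⁆ 0
  | serre_fork (e : Sgn) (i j : ℤ) (r : ℕ) (hf : IsFork n i j) :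
      DRel n ⁅X n e i 0, ⁅X n e i 0, X n e j (2 * r + 1)⁆⁆ 0
  | loop (u : ℤ) :
      DRel n
        (⁅X n .pos 1 1, ⁅X n .neg 1 0,
            loopCartan n (fun i => X n .pos i 0) (fun i => X n .neg i 0) u⁆⁆ -
          ⁅X n .pos 1 0, ⁅X n .neg 1 1,
            loopCartan n (fun i => X n .pos i 0) (fun i => X n .neg i 0) u⁆⁆) 0

/-- The Lie ideal generated by the defining relations. -/
noncomputable def DIdeal (n : ℕ) : LieIdeal ℂ (DFree n) :=
  LieSubmodule.lieSpan ℂ (DFree n) {x | ∃ a b, DRel n a b ∧ x = a - b}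

/-- The Lie algebra `D(2n)`. -/
abbrev D (n : ℕ) : Type := DFree n ⧸ DIdeal n

/-- The element `H_{i,r}` of `D(2n)`. -/
noncomputable def D.H (n : ℕ) (i : ℤ) (r : ℕ) : D n := LieSubmodule.Quotient.mk (DFree.H n i r)

/-- The element `X^±_{i,r}` of `D(2n)`. -/
noncomputable def D.X (n : ℕ) (s : Sgn) (i : ℤ) (r : ℕ) : D n :=
  LieSubmodule.Quotient.mk (DFree.X n s i r)

/-! ### The associative algebra with the minimalistic presentation -/

/-- Indices of the generators `h_{i,r}`: `h_{i,0}` for `0 ≤ i ≤ n` and `h_{i,1}` for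
`1 ≤ i ≤ n-1`. -/
def ValidMinH (n : ℕ) (i : ℤ) (r : ℕ) : Prop :=
  (0 ≤ i ∧ i ≤ (n : ℤ) ∧ r = 0) ∨ (1 ≤ i ∧ i ≤ (n : ℤ) - 1 ∧ r = 1)

/-- Indices of the generators `x^±_{i,r}`: `0 ≤ i ≤ n` and `r ∈ {0, 1}`. -/
def ValidMinX (n : ℕ) (i : ℤ) (r : ℕ) : Prop :=
  0 ≤ i ∧ i ≤ (n : ℤ) ∧ (r = 0 ∨ r = 1)

/-- The generators of the minimalistic presentation. -/
inductive MinGen (n : ℕ) : Type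
  | h (i : ℤ) (r : ℕ) (hi : ValidMinH n i r) : MinGen n
  | x (s : Sgn) (i : ℤ) (r : ℕ) (hi : ValidMinX n i r) : MinGen n

/-- The free associative algebra on these generators; brackets in it are commutators. -/
abbrev MinFree (n : ℕ) : Type := FreeAlgebra ℂ (MinGen n)

open Classical in
/-- `h_{i,r}` in the free algebra (`0` if there is no such generator). -/
noncomputable def MinFree.h (n : ℕ) (i : ℤ) (r : ℕ) : MinFree n :=
  if hi : ValidMinH n i r then FreeAlgebra.ι ℂ (MinGen.h i r hi) else 0

open Classical in
/-- `x^±_{i,r}` in the free algebra (`0` if there is no such generator). -/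
noncomputable def MinFree.x (n : ℕ) (s : Sgn) (i : ℤ) (r : ℕ) : MinFree n :=
  if hi : ValidMinX n i r then FreeAlgebra.ι ℂ (MinGen.x s i r hi) else 0

open MinFree in
/-- The minimalistic relations; `MinRel n a b` is the relation `a = b`. -/
inductive MinRel (n : ℕ) : MinFree n → MinFree n → Prop
  | hh (i j : ℤ) (r s : ℕ) (hi : ValidMinH n i r) (hj : ValidMinH n j s) :
      MinRel n ⁅h n i r, h n j s⁆ 0
  | hx (e : Sgn) (i j : ℤ) (r : ℕ) (hi : ValidMinH n i r) (hj : 0 ≤ j ∧ j ≤ (n : ℤ)) :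
      MinRel n ⁅h n i r, x n e j 0⁆ ((e.toInt * cartan n r i j) • x n e j r)
  | xx_same (i : ℤ) (hi : 0 ≤ i ∧ i ≤ (n : ℤ)) :
      MinRel n ⁅x n .pos i 0, x n .neg i 0⁆ (h n i 0)
  | xx_diff (i j : ℤ) (hi : 0 ≤ i ∧ i ≤ (n : ℤ)) (hj : 0 ≤ j ∧ j ≤ (n : ℤ)) (hij : i ≠ j) :
      MinRel n ⁅x n .pos i 0, x n .neg j 0⁆ 0
  | xx_one_mid (i : ℤ) (hi : 1 ≤ i ∧ i ≤ (n : ℤ) - 1) :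
      MinRel n ⁅x n .pos i 1, x n .neg i 0⁆ (h n i 1)
  | xx_one_last :
      MinRel n ⁅x n .pos n 1, x n .neg n 0⁆ (h n ((n : ℤ) - 1) 1)
  | xx_one_zero :
      MinRel n ⁅x n .pos 0 1, x n .neg 0 0⁆ (h n 1 1)
  | same_node (e : Sgn) (i : ℤ) (hi : 0 ≤ i ∧ i ≤ (n : ℤ)) :
      MinRel n ⁅x n e i 1, x n e i 0⁆ 0
  | serre_two (e : Sgn) (i j : ℤ) (hi : 0 ≤ i ∧ i ≤ (n : ℤ)) (hj : 0 ≤ j ∧ j ≤ (n : ℤ))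
      (ha : cartan n 0 i j = 0) :
      MinRel n ⁅x n e i 0, x n e j 0⁆ 0
  | serre_three (e : Sgn) (i j : ℤ) (hi : 0 ≤ i ∧ i ≤ (n : ℤ)) (hj : 0 ≤ j ∧ j ≤ (n : ℤ))
      (ha : cartan n 0 i j = -1) :
      MinRel n ⁅x n e i 0, ⁅x n e i 0, x n e j 0⁆⁆ 0
  | fork_last (e : Sgn) :
      MinRel n ⁅⁅x n .pos ((n : ℤ) - 1) 1, x n .neg ((n : ℤ) - 1) 1⁆, x n e n 0⁆ 0
  | fork_zero (e : Sgn) :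
      MinRel n ⁅⁅x n .pos 0 1, x n .neg 0 1⁆, x n e 1 0⁆ 0
  | loop (u : ℤ) :
      MinRel n
        (⁅x n .pos 1 1, ⁅x n .neg 1 0,
            loopCartan n (fun i => x n .pos i 0) (fun i => x n .neg i 0) u⁆⁆ -
          ⁅x n .pos 1 0, ⁅x n .neg 1 1,
            loopCartan n (fun i => x n .pos i 0) (fun i => x n .neg i 0) u⁆⁆) 0

/-- The associative algebra `D̃(2n)` given by the minimalistic presentation. -/
abbrev DMin (n : ℕ) : Type := RingQuot (MinRel n)

/-- The element `h_{i,r}` of `D̃(2n)`. -/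
noncomputable def DMin.h (n : ℕ) (i : ℤ) (r : ℕ) : DMin n :=
  RingQuot.mkAlgHom ℂ (MinRel n) (MinFree.h n i r)

/-- The element `x^±_{i,r}` of `D̃(2n)`. -/
noncomputable def DMin.x (n : ℕ) (s : Sgn) (i : ℤ) (r : ℕ) : DMin n :=
  RingQuot.mkAlgHom ℂ (MinRel n) (MinFree.x n s i r)

end TwistedD

/-! The map from the minimalistic algebra to U(D(2n)) exists because the minimalistic relations are
low-degree cases of those of D(2n). The substance is the inverse: inside the minimalistic algebra
one constructs all generators of D(2n) and derives all their relations. The element of degree r + 1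
at a node is obtained from degree r by bracketing with a degree-one Cartan element t_i, where t_0 =
h_{1,1} and t_n = h_{n-1,1} (`minX`). The outcome is axiomatised as a `CurrentSystem`, symmetric
under the Chevalley involution, so most facts are proved for one sign only.

For two distinct nodes not forming a fork pair, a combination of t_i and t_j raises the degree at
one node and kills the other (`exists_separating`), and low-degree relations propagate to all
degrees. Within one node, [x^+_{i,r}, x^-_{i,s}] depends only on r + s (`lie_pos_neg_eq`): the
defect [t_i, K_{i,m}], with K_{i,m} = [x^+_{i,m}, x^-_{i,0}], is compared with that of a
neighbouring node and forced to vanish.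

On a fork pair t_i and t_j act identically and separate nothing. The fork relation makes K_{i,2} act
by 2 on its own node and by 0 on the partner, which separates in steps of two. Hence all brackets
across a fork of even total degree vanish (`fork_even`). Those of odd total degree survive: up to
sign, those between opposite-sign elements are the generators X_{-1} and X_{n+1}, and they identify
the odd coroots of the two fork nodes (`loopCoroot_eq_of_fork`). The loop relation is the same in
both presentations and is only transported.

Finally, D(2n) is generated in low degree, since H_{i,1} raises the degree of the X's and the other
generators are brackets of these. So both composites are determined by the low generators, which
they fix. -/

namespace TwistedD

/-- The opposite sign. -/
def Sgn.flip : Sgn → Sgn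
  | .pos => .neg
  | .neg => .pos

/-- The complex number `±1` attached to a sign. -/
def Sgn.toC : Sgn → ℂ
  | .pos => 1
  | .neg => -1

theorem Sgn.toC_flip (e : Sgn) : e.flip.toC = -e.toC := by
  cases e <;> simp [Sgn.flip, Sgn.toC]

theorem Sgn.toC_eq_toInt (e : Sgn) : e.toC = ((e.toInt : ℤ) : ℂ) := by
  cases e <;> simp [Sgn.toInt, Sgn.toC]

/-! ### Abstract current systems -/

section Lie

variable {I L : Type} [LieRing L] [LieAlgebra ℂ L]

/-- The bracket with `d` acts on a bracket of two sequences by shifting their arguments. -/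
theorem lie_lie_of_shift {a b : ℕ → L} {d : L} {k : ℕ} {α β : ℂ}
    (ha : ∀ r, ⁅d, a r⁆ = α • a (r + k)) (hb : ∀ s, ⁅d, b s⁆ = β • b (s + k)) (r s : ℕ) :
    ⁅d, ⁅a r, b s⁆⁆ = α • ⁅a (r + k), b s⁆ + β • ⁅a r, b (s + k)⁆ := by
  rw [leibniz_lie, ha, hb, smul_lie, lie_smul]

/-- Elements `x^±_{i,r}` of a Lie algebra attached to the nodes of a diagram with edges `adj` and
fork pairs `fork`, together with `t_i` (degree one) and `h_i` (degree zero), subject to the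
relations of low degree. -/
structure CurrentSystem (adj fork : I → I → Prop) (x : Sgn → I → ℕ → L) (t h : I → L) : Prop where
  adj_symm : ∀ {i j}, adj i j → adj j i
  fork_symm : ∀ {i j}, fork i j → fork j i
  adj_ne : ∀ {i j}, adj i j → i ≠ j
  fork_ne : ∀ {i j}, fork i j → i ≠ j
  not_fork_of_adj : ∀ {i j}, adj i j → ¬ fork i j
  exists_adj : ∀ i, ∃ j, adj i j
  exists_adj_fork : ∀ {i j}, fork i j → ∃ k, adj k i ∧ adj k j
  t_self : ∀ e i r, ⁅t i, x e i r⁆ = (2 * e.toC) • x e i (r + 1)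
  t_adj : ∀ e {i j} r, adj i j → ⁅t i, x e j r⁆ = (-e.toC) • x e j (r + 1)
  t_fork : ∀ e {i j} r, fork i j → ⁅t i, x e j r⁆ = (2 * e.toC) • x e j (r + 1)
  t_far : ∀ e {i j} r, i ≠ j → ¬ adj i j → ¬ fork i j → ⁅t i, x e j r⁆ = 0
  t_t : ∀ i j, ⁅t i, t j⁆ = 0
  t_h : ∀ i j, ⁅t i, h j⁆ = 0
  h_self : ∀ e i r, ⁅h i, x e i r⁆ = (2 * e.toC) • x e i r
  h_adj : ∀ e {i j} r, adj i j → ⁅h i, x e j r⁆ = (-e.toC) • x e j r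
  h_far : ∀ e {i j} r, i ≠ j → ¬ adj i j → ⁅h i, x e j r⁆ = 0
  pos_neg : ∀ i, ⁅x .pos i 0, x .neg i 0⁆ = h i
  pos_one_neg : ∀ i, ⁅x .pos i 1, x .neg i 0⁆ = t i
  pos_neg_ne : ∀ {i j}, i ≠ j → ⁅x .pos i 0, x .neg j 0⁆ = 0
  one_zero : ∀ e i, ⁅x e i 1, x e i 0⁆ = 0
  serre_two : ∀ e {i j}, i ≠ j → ¬ adj i j → ⁅x e i 0, x e j 0⁆ = 0
  serre_three : ∀ e {i j}, adj i j → ⁅x e i 0, ⁅x e i 0, x e j 0⁆⁆ = 0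
  fork_rel : ∀ {i j}, fork i j → (∀ e, ⁅⁅x .pos i 1, x .neg i 1⁆, x e j 0⁆ = 0) ∨
    (∀ e, ⁅⁅x .pos j 1, x .neg j 1⁆, x e i 0⁆ = 0)

/-- The element `[x^+_{i,m}, x^-_{i,0}]`. -/
def loopCoroot (x : Sgn → I → ℕ → L) (i : I) (m : ℕ) : L := ⁅x .pos i m, x .neg i 0⁆

namespace CurrentSystem

variable {adj fork : I → I → Prop} {x : Sgn → I → ℕ → L} {t h : I → L}

/-- Since t_i commutes with h_i, applying it to [x^+_{i,0}, x^-_{i,0}] = h_i gives zero, and the two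
resulting terms must agree. -/
theorem pos_neg_one (S : CurrentSystem adj fork x t h) (i : I) :
    ⁅x .pos i 0, x .neg i 1⁆ = t i := by
  have e1 := lie_lie_of_shift (S.t_self .pos i) (S.t_self .neg i) 0 0
  rw [S.pos_neg, S.t_h] at e1
  simp only [zero_add, S.pos_one_neg, Sgn.toC] at e1
  linear_combination (norm := module) (1 / 2 : ℂ) • e1

/-- The Chevalley involution. -/
theorem flip (S : CurrentSystem adj fork x t h) :
    CurrentSystem adj fork (fun e => x e.flip) (fun i => -t i) (fun i => -h i) where
  adj_symm := S.adj_symm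
  fork_symm := S.fork_symm
  adj_ne := S.adj_ne
  fork_ne := S.fork_ne
  not_fork_of_adj := S.not_fork_of_adj
  exists_adj := S.exists_adj
  exists_adj_fork := S.exists_adj_fork
  t_self e i r := by rw [neg_lie, S.t_self, Sgn.toC_flip]; module
  t_adj e i j r hij := by rw [neg_lie, S.t_adj _ _ hij, Sgn.toC_flip]; module
  t_fork e i j r hij := by rw [neg_lie, S.t_fork _ _ hij, Sgn.toC_flip]; module
  t_far e i j r h1 h2 h3 := by rw [neg_lie, S.t_far _ _ h1 h2 h3, neg_zero]
  t_t i j := by rw [neg_lie, lie_neg, S.t_t, neg_zero, neg_zero]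
  t_h i j := by rw [neg_lie, lie_neg, S.t_h, neg_zero, neg_zero]
  h_self e i r := by rw [neg_lie, S.h_self, Sgn.toC_flip]; module
  h_adj e i j r hij := by rw [neg_lie, S.h_adj _ _ hij, Sgn.toC_flip]; module
  h_far e i j r h1 h2 := by rw [neg_lie, S.h_far _ _ h1 h2, neg_zero]
  pos_neg i := by rw [← S.pos_neg i, lie_skew]; rfl
  pos_one_neg i := by rw [← S.pos_neg_one i, lie_skew]; rfl
  pos_neg_ne hij := by
    rw [← lie_skew, neg_eq_zero]; exact S.pos_neg_ne hij.symm
  one_zero e i := S.one_zero _ i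
  serre_two e _ _ h1 h2 := S.serre_two _ h1 h2
  serre_three e _ _ hij := S.serre_three _ hij
  fork_rel {i j} hf := by
    refine (S.fork_rel hf).imp (fun H e => ?_) (fun H e => ?_)
    all_goals
      rw [← lie_skew (x Sgn.pos.flip _ 1), neg_lie, neg_eq_zero]
      exact H _

/-! ### Brackets between distinct nodes that do not form a fork pair -/

/-- For adjacent nodes the matrix with rows (2, -1) and (-1, 2) is invertible; for distant ones t_i
alone suffices. On a fork pair the matrix has all entries 2 and is singular, hence the exclusion. -/
theorem exists_separating (S : CurrentSystem adj fork x t h) {i j : I} (hij : i ≠ j)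
    (hf : ¬ fork i j) :
    ∃ d : L, (∀ e r, ⁅d, x e i r⁆ = e.toC • x e i (r + 1)) ∧
      ∀ e r, ⁅d, x e j r⁆ = (0 : ℂ) • x e j (r + 1) := by
  by_cases ha : adj i j
  -- The coefficients a, b solve 2a - b = 1 and -a + 2b = 0.
  · refine ⟨(2 / 3 : ℂ) • t i + (1 / 3 : ℂ) • t j, fun e r => ?_, fun e r => ?_⟩
    · rw [add_lie, smul_lie, smul_lie, S.t_self, S.t_adj _ _ (S.adj_symm ha)]; module
    · rw [add_lie, smul_lie, smul_lie, S.t_self, S.t_adj _ _ ha]; module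
  · refine ⟨(1 / 2 : ℂ) • t i, fun e r => ?_, fun e r => ?_⟩
    · rw [smul_lie, S.t_self]; module
    · rw [smul_lie, S.t_far _ _ hij ha hf, smul_zero, zero_smul]

/-- Separating elements for both orders of the pair raise the two degrees independently, so
vanishing spreads from degree (0, 0). -/
theorem lie_pos_neg (S : CurrentSystem adj fork x t h) {i j : I} (hij : i ≠ j)
    (hf : ¬ fork i j) (r s : ℕ) : ⁅x .pos i r, x .neg j s⁆ = 0 := by
  obtain ⟨d, hd, hd'⟩ := S.exists_separating hij hf
  obtain ⟨c, hc, hc'⟩ := S.exists_separating hij.symm (fun H => hf (S.fork_symm H))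
  have step : ∀ r s, ⁅x .pos i r, x .neg j s⁆ = 0 →
      ⁅x .pos i (r + 1), x .neg j s⁆ = 0 ∧ ⁅x .pos i r, x .neg j (s + 1)⁆ = 0 := by
    intro r s H
    have e1 := lie_lie_of_shift (hd .pos) (hd' .neg) r s
    have e2 := lie_lie_of_shift (hc' .pos) (hc .neg) r s
    rw [H, lie_zero, zero_smul, add_zero] at e1
    rw [H, lie_zero, zero_smul, zero_add] at e2
    exact ⟨(smul_eq_zero.mp e1.symm).resolve_left (by simp [Sgn.toC]),
      (smul_eq_zero.mp e2.symm).resolve_left (by simp [Sgn.toC])⟩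
  induction s with
  | succ s ih => exact (step _ _ ih).2
  | zero =>
    induction r with
    | zero => exact S.pos_neg_ne hij
    | succ r ih => exact (step _ _ ih).1

theorem lie_far (S : CurrentSystem adj fork x t h) (e : Sgn) {i j : I} (hij : i ≠ j)
    (ha : ¬ adj i j) (hf : ¬ fork i j) (r s : ℕ) : ⁅x e i r, x e j s⁆ = 0 := by
  obtain ⟨d, hd, hd'⟩ := S.exists_separating hij hf
  obtain ⟨c, hc, hc'⟩ := S.exists_separating hij.symm (fun H => hf (S.fork_symm H))
  have he : e.toC ≠ 0 := by cases e <;> simp [Sgn.toC]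
  have step : ∀ r s, ⁅x e i r, x e j s⁆ = 0 →
      ⁅x e i (r + 1), x e j s⁆ = 0 ∧ ⁅x e i r, x e j (s + 1)⁆ = 0 := by
    intro r s H
    have e1 := lie_lie_of_shift (hd e) (hd' e) r s
    have e2 := lie_lie_of_shift (hc' e) (hc e) r s
    rw [H, lie_zero, zero_smul, add_zero] at e1
    rw [H, lie_zero, zero_smul, zero_add] at e2
    exact ⟨(smul_eq_zero.mp e1.symm).resolve_left he, (smul_eq_zero.mp e2.symm).resolve_left he⟩
  induction s with
  | succ s ih => exact (step _ _ ih).2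
  | zero =>
    induction r with
    | zero => exact S.serre_two e hij ha
    | succ r ih => exact (step _ _ ih).1

theorem lie_neg_pos (S : CurrentSystem adj fork x t h) {i j : I} (hij : i ≠ j)
    (hf : ¬ fork i j) (r s : ℕ) : ⁅x .neg i r, x .pos j s⁆ = 0 :=
  S.flip.lie_pos_neg hij hf r s

/-- Raising the Serre relation by one degree at i gives [x_{i,0}, [x_{i,1}, x_{j,0}]] = 0. Lowering
this with x^-_{i,0} leaves one term from h_i, of total weight 2 - 1 = 1, and one from t_i: the two
sides of the claim. -/
theorem shift_pos_zero (S : CurrentSystem adj fork x t h) {i j : I} (ha : adj i j) :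
    ⁅x .pos i 1, x .pos j 0⁆ = ⁅x .pos i 0, x .pos j 1⁆ := by
  have hij := S.adj_ne ha
  have hf := S.not_fork_of_adj ha
  obtain ⟨d, hd, hd'⟩ := S.exists_separating hij hf
  have e1 := congrArg (fun y => ⁅d, y⁆) (S.serre_three .pos ha)
  simp only [leibniz_lie d, hd, hd', Sgn.toC, one_smul, zero_smul, lie_zero, zero_add,
    add_zero] at e1
  -- The two terms of `e1` coincide because x_{i,0} and x_{i,1} commute.
  have e2 : ⁅x .pos i 0, ⁅x .pos i 1, x .pos j 0⁆⁆ = 0 := by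
    rw [leibniz_lie (x .pos i 1), S.one_zero, zero_lie, zero_add] at e1
    rw [← two_smul ℂ] at e1
    simpa using e1
  have e3 : ⁅x .neg i 0, x .pos j 0⁆ = 0 := S.lie_neg_pos hij hf 0 0
  have e4 := congrArg (fun y => ⁅x .neg i 0, y⁆) e2
  have e5 : ⁅x .neg i 0, x .pos i 0⁆ = -h i := by rw [← lie_skew, S.pos_neg]
  have e6 : ⁅x .neg i 0, x .pos i 1⁆ = -t i := by rw [← lie_skew, S.pos_one_neg]
  simp only [leibniz_lie (x .neg i 0), e3, e5, e6, lie_zero, add_zero, neg_lie, lie_neg,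
    leibniz_lie (h i), S.h_self, S.h_adj _ _ ha, S.t_adj _ _ ha, Sgn.toC, smul_lie,
    lie_smul] at e4
  linear_combination (norm := module) -e4

theorem shift_adj (S : CurrentSystem adj fork x t h) (e : Sgn) {i j : I} (ha : adj i j)
    (r s : ℕ) : ⁅x e i (r + 1), x e j s⁆ = ⁅x e i r, x e j (s + 1)⁆ := by
  have h0 : ⁅x e i 1, x e j 0⁆ = ⁅x e i 0, x e j 1⁆ := by
    cases e
    · exact S.shift_pos_zero ha
    · exact S.flip.shift_pos_zero ha
  have hij := S.adj_ne ha
  have hf := S.not_fork_of_adj ha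
  obtain ⟨d, hd, hd'⟩ := S.exists_separating hij hf
  obtain ⟨c, hc, hc'⟩ := S.exists_separating hij.symm (fun H => hf (S.fork_symm H))
  have he : e.toC ≠ 0 := by cases e <;> simp [Sgn.toC]
  have d1 := lie_lie_of_shift (hd e) (hd' e)
  have c1 := lie_lie_of_shift (hc' e) (hc e)
  induction s with
  | succ s ih =>
    have := congrArg (fun y => ⁅c, y⁆) ih
    simpa [c1, he] using this
  | zero =>
    induction r with
    | zero => exact h0
    | succ r ih =>
      have := congrArg (fun y => ⁅d, y⁆) ih
      simpa [d1, he] using this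

theorem lie_adj (S : CurrentSystem adj fork x t h) (e : Sgn) {i j : I} (ha : adj i j)
    (r s : ℕ) : ⁅x e i r, x e j s⁆ = ⁅x e i 0, x e j (s + r)⁆ := by
  induction r generalizing s with
  | zero => rfl
  | succ r ih => rw [S.shift_adj e ha, ih]; congr 2; ring_nf

/-- Raising the degree at i produces a second term [x_{i,r}, [x_{i,1}, x_{j,u}]], which equals
[x_{i,r}, [x_{i,0}, x_{j,u+1}]] and vanishes by induction. This is why the induction on r runs over
all u. -/
theorem serre_adj_aux (S : CurrentSystem adj fork x t h) (e : Sgn) {i j : I} (ha : adj i j)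
    (r u : ℕ) : ⁅x e i r, ⁅x e i 0, x e j u⁆⁆ = 0 := by
  have hij := S.adj_ne ha
  have hf := S.not_fork_of_adj ha
  obtain ⟨d, hd, hd'⟩ := S.exists_separating hij hf
  obtain ⟨c, hc, hc'⟩ := S.exists_separating hij.symm (fun H => hf (S.fork_symm H))
  have he : e.toC ≠ 0 := by cases e <;> simp [Sgn.toC]
  have d1 := lie_lie_of_shift (hd e) (hd' e)
  induction r generalizing u with
  | zero =>
    induction u with
    | zero => exact S.serre_three e ha
    | succ u ih =>
      have := congrArg (fun y => ⁅c, y⁆) ih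
      simpa [leibniz_lie c, hc, hc', he] using this
  | succ r ih =>
    have := congrArg (fun y => ⁅d, y⁆) (ih u)
    rw [leibniz_lie d, d1, hd, lie_zero] at this
    rw [S.shift_adj e ha, zero_smul, add_zero, lie_smul, ih, smul_zero, add_zero, smul_lie] at this
    simpa [he] using this

theorem serre_adj (S : CurrentSystem adj fork x t h) (e : Sgn) {i j : I} (ha : adj i j)
    (r s u : ℕ) : ⁅x e i r, ⁅x e i s, x e j u⁆⁆ = 0 := by
  rw [S.lie_adj e ha, S.serre_adj_aux e ha]

/-! ### Brackets within one node, and the loop coroots -/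

/-- For a neighbour j, the bracket W commutes with x^+_{j,0} by the Serre relations and with
x^-_{j,0}, hence with h_j. But h_j acts on W by -2. -/
theorem same_node_pos (S : CurrentSystem adj fork x t h) (i : I) (r s : ℕ) :
    ⁅x .pos i r, x .pos i s⁆ = 0 := by
  obtain ⟨j, ha⟩ := S.exists_adj i
  have hij := S.adj_ne ha
  have hf := S.not_fork_of_adj ha
  set W := ⁅x .pos i r, x .pos i s⁆ with hW
  have e1 : ⁅W, x .pos j 0⁆ = 0 := by
    rw [hW, lie_lie, S.serre_adj _ ha, S.serre_adj _ ha, sub_zero]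
  have e2 : ⁅W, x .neg j 0⁆ = 0 := by
    rw [hW, lie_lie, S.lie_pos_neg hij hf, S.lie_pos_neg hij hf, lie_zero, lie_zero, sub_zero]
  have e3 : ⁅h j, W⁆ = 0 := by
    rw [← lie_skew, neg_eq_zero, ← S.pos_neg, leibniz_lie, e1, e2, zero_lie, lie_zero, add_zero]
  have e4 := lie_lie_of_shift (k := 0) (fun u => S.h_adj .pos u (S.adj_symm ha))
    (fun u => S.h_adj .pos u (S.adj_symm ha)) r s
  rw [← hW, e3] at e4
  simp only [Sgn.toC, add_zero, ← hW] at e4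
  linear_combination (norm := module) (1 / 2 : ℂ) • e4

theorem same_node (S : CurrentSystem adj fork x t h) (e : Sgn) (i : I) (r s : ℕ) :
    ⁅x e i r, x e i s⁆ = 0 := by
  cases e
  · exact S.same_node_pos i r s
  · exact S.flip.same_node_pos i r s

theorem loopCoroot_zero (S : CurrentSystem adj fork x t h) (i : I) : loopCoroot x i 0 = h i :=
  S.pos_neg i

theorem loopCoroot_one (S : CurrentSystem adj fork x t h) (i : I) : loopCoroot x i 1 = t i :=
  S.pos_one_neg i

/-- As x^-_{i,s} commutes with x^+_j, only [x^+_i, x^+_j] is affected by x^+_{i,r}, and there degree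
moves freely from i to j. -/
theorem lie_pos_neg_pos_adj (S : CurrentSystem adj fork x t h) {i j : I} (ha : adj i j)
    (r s u : ℕ) :
    ⁅⁅x .pos i r, x .neg i s⁆, x .pos j u⁆ = ⁅⁅x .pos i 0, x .neg i s⁆, x .pos j (u + r)⁆ := by
  have e1 : ∀ u, ⁅x .neg i s, x .pos j u⁆ = 0 :=
    fun u => S.lie_neg_pos (S.adj_ne ha) (S.not_fork_of_adj ha) s u
  rw [lie_lie, lie_lie, e1, e1, lie_zero, lie_zero, S.lie_adj _ ha]

/-- Independence of the splitting of m is a hypothesis so that the lemma is available inside the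
induction proving it. In positive degree the coroot is split with a single unit on one side; the
remaining degree passes to x_j, leaving t_i. -/
theorem loopCoroot_adj_aux (S : CurrentSystem adj fork x t h) {m : ℕ}
    (hm : ∀ i r s, r + s = m → ⁅x .pos i r, x .neg i s⁆ = loopCoroot x i m) (e : Sgn)
    {i j : I} (ha : adj i j) (u : ℕ) :
    ⁅loopCoroot x i m, x e j u⁆ = (-e.toC) • x e j (u + m) := by
  rcases m with _ | m
  · rw [S.loopCoroot_zero, S.h_adj _ _ ha, add_zero]
  · cases e
    · rw [← hm i m 1 rfl, S.lie_pos_neg_pos_adj ha, S.pos_neg_one, S.t_adj _ _ ha, add_assoc]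
    · have := S.flip.lie_pos_neg_pos_adj ha m 1 u
      simp only [Sgn.flip] at this
      rw [← hm i 1 m (by omega), ← lie_skew (x .pos i 1), neg_lie, this,
        ← lie_skew (x .neg i 0), neg_lie, neg_neg, S.pos_one_neg, S.t_adj _ _ ha, add_assoc]

/-- Induction on the total degree. If it holds in degree m + 1, the only obstruction in degree m + 2
is [t_i, K_{i,m+1}], which must be shown to vanish at every node. -/
theorem lie_pos_neg_eq (S : CurrentSystem adj fork x t h) (m : ℕ) :
    (∀ i r s, r + s = m → ⁅x .pos i r, x .neg i s⁆ = loopCoroot x i m) := by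
  induction m with
  | zero =>
    intro i r s hrs
    obtain ⟨rfl, rfl⟩ : r = 0 ∧ s = 0 := by omega
    rfl
  | succ m ih =>
    rcases m with _ | m
    · intro i r s hrs
      obtain ⟨rfl, rfl⟩ | ⟨rfl, rfl⟩ : (r = 1 ∧ s = 0) ∨ (r = 0 ∧ s = 1) := by omega
      · rfl
      · rw [S.pos_neg_one, S.loopCoroot_one]
    · have t1 : ∀ i r s, r + s = m + 1 → ⁅t i, loopCoroot x i (m + 1)⁆ =
          (2 : ℂ) • ⁅x .pos i (r + 1), x .neg i s⁆ - (2 : ℂ) • ⁅x .pos i r, x .neg i (s + 1)⁆ := by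
        intro i r s hrs
        rw [← ih i r s hrs, lie_lie_of_shift (S.t_self .pos i) (S.t_self .neg i)]
        simp only [Sgn.toC]
        module
      -- By `t1`, each unit of degree moved from x^+ to x^- costs the same amount, half of [t_i,
      -- K_{i,m+1}].
      have t2 : ∀ i s r, r + s = m + 1 + 1 → ⁅x .pos i r, x .neg i s⁆ =
          loopCoroot x i (m + 1 + 1) - ((s : ℂ) / 2) • ⁅t i, loopCoroot x i (m + 1)⁆ := by
        intro i s
        induction s with
        | zero => intro r hr; obtain rfl : r = m + 1 + 1 := by omega
                  simp [loopCoroot]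
        | succ s ihs =>
          intro r hr
          have := ihs (r + 1) (by omega)
          have h1 := t1 i r s (by omega)
          push_cast
          linear_combination (norm := module) this + (1 / 2 : ℂ) • h1
      -- The bracket of K_{i,m+1} with t_j is computed twice: letting K_{i,m+1} act on t_j =
      -- [x^+_{j,1}, x^-_{j,0}], where m + 1 units move at j, and letting t_j act on K_{i,m+1},
      -- where one unit moves at i.
      have t3 : ∀ i j, adj i j → ⁅t i, loopCoroot x i (m + 1)⁆ =
          (-((m : ℂ) + 1)) • ⁅t j, loopCoroot x j (m + 1)⁆ := by
        intro i j ha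
        have e1 := lie_lie_of_shift (fun u => S.loopCoroot_adj_aux ih .pos ha u)
          (fun u => S.loopCoroot_adj_aux ih .neg ha u) 1 0
        have e2 := lie_lie_of_shift (fun u => S.t_adj .pos u (S.adj_symm ha))
          (fun u => S.t_adj .neg u (S.adj_symm ha)) (m + 1) 0
        rw [S.pos_one_neg, ← lie_skew] at e1
        rw [show ⁅x .pos i (m + 1), x .neg i 0⁆ = loopCoroot x i (m + 1) from rfl] at e2
        rw [t2 j 0 _ (by omega), t2 j (0 + (m + 1)) _ (by omega)] at e1
        rw [t2 i 0 _ (by omega), t2 i (0 + 1) _ (by omega)] at e2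
        rw [e2] at e1
        simp only [Sgn.toC] at e1
        push_cast at e1
        linear_combination (norm := module) (2 : ℂ) • e1
      have t4 : ∀ i, ⁅t i, loopCoroot x i (m + 1)⁆ = 0 := by
        intro i
        obtain ⟨j, ha⟩ := S.exists_adj i
        -- Using `t3` in both directions multiplies the defect by (m + 1)². For m = 0 this says
        -- nothing, but then the coroot is t_i itself and the t's commute.
        rcases m with _ | m
        · rw [zero_add, S.loopCoroot_one, S.t_t]
        · have e1 := t3 i j ha
          rw [t3 j i (S.adj_symm ha), smul_smul] at e1
          have e2 : (1 - ((m : ℂ) + 2) ^ 2) • ⁅t i, loopCoroot x i (m + 1 + 1)⁆ = 0 := by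
            push_cast at e1
            linear_combination (norm := module) e1
          refine (smul_eq_zero.mp e2).resolve_left fun hz => ?_
          have e3 : ((m : ℂ) + 1) * ((m : ℂ) + 3) = 0 := by linear_combination -hz
          norm_cast at e3
      intro i r s hrs
      rw [t2 i s r hrs, t4, smul_zero, sub_zero]

theorem lie_pos_neg_self (S : CurrentSystem adj fork x t h) (i : I) (r s : ℕ) :
    ⁅x .pos i r, x .neg i s⁆ = loopCoroot x i (r + s) :=
  S.lie_pos_neg_eq _ i r s rfl

theorem loopCoroot_flip (S : CurrentSystem adj fork x t h) (i : I) (m : ℕ) :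
    loopCoroot (fun e => x e.flip) i m = -loopCoroot x i m := by
  have := S.lie_pos_neg_self i 0 m
  rw [zero_add] at this
  rw [← this, lie_skew]; rfl

theorem loopCoroot_adj (S : CurrentSystem adj fork x t h) (e : Sgn) {i j : I} (ha : adj i j)
    (m u : ℕ) : ⁅loopCoroot x i m, x e j u⁆ = (-e.toC) • x e j (u + m) :=
  S.loopCoroot_adj_aux (S.lie_pos_neg_eq m) e ha u

/-- Since the x^+_i commute, [[x^+_r, x^-_s], x^+_u] is symmetric in r and u. This trades the degree
of the coroot against that of x^+_i and reduces to t_i, or to h_i in total degree zero. -/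
theorem loopCoroot_self_pos (S : CurrentSystem adj fork x t h) (i : I) (m u : ℕ) :
    ⁅loopCoroot x i m, x .pos i u⁆ = (2 : ℂ) • x .pos i (u + m) := by
  have key : ∀ r s u, ⁅loopCoroot x i (r + s), x .pos i u⁆ =
      ⁅loopCoroot x i (u + s), x .pos i r⁆ := by
    intro r s u
    have e1 := leibniz_lie (x .pos i u) (x .pos i r) (x .neg i s)
    rw [S.same_node, zero_lie, zero_add] at e1
    rw [← S.lie_pos_neg_self, ← S.lie_pos_neg_self, ← lie_skew, e1, lie_skew]
  have k1 : ∀ u, ⁅loopCoroot x i (u + 1), x .pos i 0⁆ = (2 : ℂ) • x .pos i (u + 1) := by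
    intro u
    rw [← key 0 1 u, zero_add, S.loopCoroot_one, S.t_self]
    simp [Sgn.toC]
  have := key 0 m u
  rw [zero_add] at this
  rw [this]
  rcases u + m with _ | v
  · rw [S.loopCoroot_zero, S.h_self]
    simp [Sgn.toC]
  · exact k1 v

theorem loopCoroot_self (S : CurrentSystem adj fork x t h) (e : Sgn) (i : I) (m u : ℕ) :
    ⁅loopCoroot x i m, x e i u⁆ = (2 * e.toC) • x e i (u + m) := by
  cases e
  · rw [S.loopCoroot_self_pos]; simp [Sgn.toC]
  · have := S.flip.loopCoroot_self_pos i m u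
    rw [S.loopCoroot_flip, neg_lie] at this
    simp only [Sgn.flip] at this
    simp only [Sgn.toC]
    linear_combination (norm := module) -this

theorem loopCoroot_far (S : CurrentSystem adj fork x t h) (e : Sgn) {i j : I} (hij : i ≠ j)
    (ha : ¬ adj i j) (hf : ¬ fork i j) (m u : ℕ) : ⁅loopCoroot x i m, x e j u⁆ = 0 := by
  rw [loopCoroot, lie_lie]
  cases e
  · rw [S.lie_far _ hij ha hf, S.lie_neg_pos hij hf, lie_zero, lie_zero, sub_zero]
  · rw [S.lie_far _ hij ha hf, S.lie_pos_neg hij hf, lie_zero, lie_zero, sub_zero]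

/-- If `y` acts on `x^±_{j,r}` with opposite coefficients, it commutes with the coroots of `j`. -/
theorem lie_loopCoroot_eq_zero (S : CurrentSystem adj fork x t h) {j : I} {y : L} {k : ℕ} {c : ℂ}
    (hp : ∀ u, ⁅y, x .pos j u⁆ = c • x .pos j (u + k))
    (hm : ∀ u, ⁅y, x .neg j u⁆ = (-c) • x .neg j (u + k)) (m : ℕ) :
    ⁅y, loopCoroot x j m⁆ = 0 := by
  rw [loopCoroot, lie_lie_of_shift hp hm, S.lie_pos_neg_self, S.lie_pos_neg_self,
    show m + (0 + k) = m + k + 0 by ring]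
  module

theorem loopCoroot_comm (S : CurrentSystem adj fork x t h) {i j : I} (hf : ¬ fork i j)
    (m k : ℕ) : ⁅loopCoroot x i m, loopCoroot x j k⁆ = 0 := by
  by_cases hij : i = j
  · subst hij
    exact S.lie_loopCoroot_eq_zero (c := 2) (k := m)
      (fun u => by rw [S.loopCoroot_self]; simp [Sgn.toC])
      (fun u => by rw [S.loopCoroot_self]; simp [Sgn.toC]) k
  by_cases ha : adj i j
  · exact S.lie_loopCoroot_eq_zero (c := -1) (k := m)
      (fun u => by rw [S.loopCoroot_adj _ ha]; simp [Sgn.toC])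
      (fun u => by rw [S.loopCoroot_adj _ ha]; simp [Sgn.toC]) k
  · exact S.lie_loopCoroot_eq_zero (c := 0) (k := 0)
      (fun u => by rw [S.loopCoroot_far _ hij ha hf, zero_smul])
      (fun u => by rw [S.loopCoroot_far _ hij ha hf, neg_zero, zero_smul]) k

/-! ### Fork pairs: vanishing in even total degree -/

theorem not_adj_of_fork (S : CurrentSystem adj fork x t h) {i j : I} (hf : fork i j) :
    ¬ adj i j := fun ha => S.not_fork_of_adj ha hf

theorem fork_zero_zero (S : CurrentSystem adj fork x t h) (e e' : Sgn) {i j : I}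
    (hf : fork i j) : ⁅x e i 0, x e' j 0⁆ = 0 := by
  have hij := S.fork_ne hf
  cases e <;> cases e'
  · exact S.serre_two _ hij (S.not_adj_of_fork hf)
  · exact S.pos_neg_ne hij
  · exact S.flip.pos_neg_ne hij
  · exact S.serre_two _ hij (S.not_adj_of_fork hf)

/-- The bracket is killed by x^+_{i,0} and x^-_{i,0}: one of these because it commutes with both
factors, the other by the fork relation, with K_{i,2} written as [x^+_{i,2}, x^-_{i,0}] or
[x^+_{i,0}, x^-_{i,2}]. Hence h_i kills it, although its h_i-weight is ±2. -/
theorem fork_two_zero_neg (S : CurrentSystem adj fork x t h) {i j : I} (hf : fork i j)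
    (hr : ∀ e, ⁅⁅x .pos i 1, x .neg i 1⁆, x e j 0⁆ = 0) (e : Sgn) :
    ⁅x e i 2, x .neg j 0⁆ = 0 := by
  have hij := S.fork_ne hf
  have h1 := hr .neg
  rw [S.lie_pos_neg_self] at h1
  have hpos : ⁅x .pos i 0, ⁅x e i 2, x .neg j 0⁆⁆ = 0 := by
    cases e
    · rw [leibniz_lie, S.same_node, S.fork_zero_zero _ _ hf, lie_zero, zero_lie, add_zero]
    · rw [show (1 : ℕ) + 1 = 0 + 2 from rfl, ← S.lie_pos_neg_self, lie_lie,
        S.fork_zero_zero _ _ hf, lie_zero, sub_zero] at h1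
      exact h1
  have hneg : ⁅x .neg i 0, ⁅x e i 2, x .neg j 0⁆⁆ = 0 := by
    cases e
    · rw [show (1 : ℕ) + 1 = 2 + 0 from rfl, ← S.lie_pos_neg_self, lie_lie,
        S.fork_zero_zero _ _ hf, lie_zero, zero_sub, neg_eq_zero] at h1
      exact h1
    · rw [leibniz_lie, S.same_node, S.fork_zero_zero _ _ hf, lie_zero, zero_lie, add_zero]
  have h2 : ⁅h i, ⁅x e i 2, x .neg j 0⁆⁆ = 0 := by
    rw [← S.pos_neg, lie_lie, hpos, hneg, lie_zero, lie_zero, sub_zero]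
  rw [leibniz_lie, S.h_self, S.h_far _ _ hij (S.not_adj_of_fork hf), lie_zero, add_zero,
    smul_lie] at h2
  refine (smul_eq_zero.mp h2).resolve_left ?_
  cases e <;> simp [Sgn.toC]

theorem fork_two_zero_of_rel (S : CurrentSystem adj fork x t h) {i j : I} (hf : fork i j)
    (hr : ∀ e, ⁅⁅x .pos i 1, x .neg i 1⁆, x e j 0⁆ = 0) (e e' : Sgn) :
    ⁅x e i 2, x e' j 0⁆ = 0 := by
  cases e'
  · have := S.flip.fork_two_zero_neg hf (fun e => by
      rw [← lie_skew (x Sgn.pos.flip i 1), neg_lie, neg_eq_zero]; exact hr e.flip) e.flip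
    cases e <;> exact this
  · exact S.fork_two_zero_neg hf hr e

/-- The fork relation is imposed at only one node of each fork. The degree-two coroot of a common
neighbour acts on both nodes; applied to the zero bracket in degree (0, 0), it transfers the
conclusion to the other node. -/
theorem fork_two_zero_iff (S : CurrentSystem adj fork x t h) {i j : I} (hf : fork i j)
    (e e' : Sgn) : ⁅x e i 2, x e' j 0⁆ = 0 ↔ ⁅x e' j 2, x e i 0⁆ = 0 := by
  obtain ⟨k, hki, hkj⟩ := S.exists_adj_fork hf
  have := lie_lie_of_shift (fun u => S.loopCoroot_adj e hki 2 u)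
    (fun u => S.loopCoroot_adj e' hkj 2 u) 0 0
  rw [S.fork_zero_zero _ _ hf, lie_zero] at this
  have h1 : e.toC ≠ 0 := by cases e <;> simp [Sgn.toC]
  have h2 : e'.toC ≠ 0 := by cases e' <;> simp [Sgn.toC]
  rw [← lie_skew (x e' j 2), neg_eq_zero]
  constructor
  · intro H
    rw [zero_add, H, smul_zero, zero_add] at this
    exact (smul_eq_zero.mp this.symm).resolve_left (neg_ne_zero.2 h2)
  · intro H
    rw [zero_add, H, smul_zero, add_zero] at this
    exact (smul_eq_zero.mp this.symm).resolve_left (neg_ne_zero.2 h1)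

theorem fork_two_zero (S : CurrentSystem adj fork x t h) {i j : I} (hf : fork i j)
    (e e' : Sgn) : ⁅x e i 2, x e' j 0⁆ = 0 := by
  rcases S.fork_rel hf with hr | hr
  · exact S.fork_two_zero_of_rel hf hr e e'
  · exact (S.fork_two_zero_iff hf e e').2 (S.fork_two_zero_of_rel (S.fork_symm hf) hr e' e)

theorem t_loopCoroot (S : CurrentSystem adj fork x t h) (i j : I) (m : ℕ) :
    ⁅t i, loopCoroot x j m⁆ = 0 := by
  by_cases hij : i = j
  · subst hij
    exact S.lie_loopCoroot_eq_zero (c := 2) (k := 1) (fun u => by rw [S.t_self]; simp [Sgn.toC])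
      (fun u => by rw [S.t_self]; simp [Sgn.toC]) m
  by_cases ha : adj i j
  · exact S.lie_loopCoroot_eq_zero (c := -1) (k := 1)
      (fun u => by rw [S.t_adj _ _ ha]; simp [Sgn.toC])
      (fun u => by rw [S.t_adj _ _ ha]; simp [Sgn.toC]) m
  by_cases hf : fork i j
  · exact S.lie_loopCoroot_eq_zero (c := 2) (k := 1)
      (fun u => by rw [S.t_fork _ _ hf]; simp [Sgn.toC])
      (fun u => by rw [S.t_fork _ _ hf]; simp [Sgn.toC]) m
  · exact S.lie_loopCoroot_eq_zero (c := 0) (k := 0)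
      (fun u => by rw [S.t_far _ _ hij ha hf, zero_smul])
      (fun u => by rw [S.t_far _ _ hij ha hf, neg_zero, zero_smul]) m

/-- Since t_j commutes with every coroot and raises the degree of x_j, the action need only be known
on x_{j,0}. -/
theorem loopCoroot_shift (S : CurrentSystem adj fork x t h) {e : Sgn} {i j : I} {m : ℕ} {c : ℂ}
    (h0 : ⁅loopCoroot x i m, x e j 0⁆ = c • x e j m) (u : ℕ) :
    ⁅loopCoroot x i m, x e j u⁆ = c • x e j (u + m) := by
  have he : (2 * e.toC) ≠ 0 := by cases e <;> simp [Sgn.toC]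
  induction u with
  | zero => rw [h0, zero_add]
  | succ u ih =>
    have := congrArg (fun y => ⁅t j, y⁆) ih
    simp only [leibniz_lie (t j), S.t_loopCoroot, zero_lie, zero_add, S.t_self, lie_smul] at this
    rw [smul_comm c] at this
    rw [smul_right_injective L he this, add_right_comm]

theorem loopCoroot_two_fork (S : CurrentSystem adj fork x t h) (e : Sgn) {i j : I}
    (hf : fork i j) (u : ℕ) : ⁅loopCoroot x i 2, x e j u⁆ = (0 : ℂ) • x e j (u + 2) := by
  refine S.loopCoroot_shift ?_ u
  rw [loopCoroot, lie_lie, S.fork_two_zero hf, S.fork_zero_zero _ _ hf, lie_zero, lie_zero,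
    sub_zero, zero_smul]

/-- The degree-two coroots do for a fork pair what t_i and t_j cannot: they move one node and kill
the other. -/
theorem fork_add_two (S : CurrentSystem adj fork x t h) {e e' : Sgn} {i j : I} (hf : fork i j)
    {r s : ℕ} (H : ⁅x e i r, x e' j s⁆ = 0) :
    ⁅x e i (r + 2), x e' j s⁆ = 0 ∧ ⁅x e i r, x e' j (s + 2)⁆ = 0 := by
  have h1 : e.toC ≠ 0 := by cases e <;> simp [Sgn.toC]
  have h2 : e'.toC ≠ 0 := by cases e' <;> simp [Sgn.toC]
  have e1 := lie_lie_of_shift (fun u => S.loopCoroot_self e i 2 u)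
    (fun u => S.loopCoroot_two_fork e' hf u) r s
  have e2 := lie_lie_of_shift (fun u => S.loopCoroot_two_fork e (S.fork_symm hf) u)
    (fun u => S.loopCoroot_self e' j 2 u) r s
  rw [H, lie_zero, zero_smul, add_zero] at e1
  rw [H, lie_zero, zero_smul, zero_add] at e2
  exact ⟨(smul_eq_zero.mp e1.symm).resolve_left (mul_ne_zero two_ne_zero h1),
    (smul_eq_zero.mp e2.symm).resolve_left (mul_ne_zero two_ne_zero h2)⟩

/-- Applying t_i twice to the zero bracket in degree (0, 0) yields terms in degrees (2, 0), (1, 1),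
(0, 2). The outer ones vanish, and the two middle contributions add up. -/
theorem fork_one_one (S : CurrentSystem adj fork x t h) (e e' : Sgn) {i j : I}
    (hf : fork i j) : ⁅x e i 1, x e' j 1⁆ = 0 := by
  have h1 : e.toC ≠ 0 := by cases e <;> simp [Sgn.toC]
  have h2 : e'.toC ≠ 0 := by cases e' <;> simp [Sgn.toC]
  have d := lie_lie_of_shift (fun u => S.t_self e i u) (fun u => S.t_fork e' u hf)
  have e1 := d 0 0
  rw [S.fork_zero_zero _ _ hf, lie_zero] at e1
  have h02 := (S.fork_add_two hf (S.fork_zero_zero e e' hf)).2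
  rw [zero_add] at h02
  have e2 := congrArg (fun y => ⁅t i, y⁆) e1
  simp only [lie_add, lie_smul, d, lie_zero, zero_add, one_add_one_eq_two,
    S.fork_two_zero hf, h02, smul_zero, add_zero,
    smul_smul] at e2
  rw [← add_smul] at e2
  refine (smul_eq_zero.mp e2.symm).resolve_left ?_
  rw [show 2 * e.toC * (2 * e'.toC) + 2 * e'.toC * (2 * e.toC) = 8 * (e.toC * e'.toC) by ring]
  exact mul_ne_zero (by norm_num) (mul_ne_zero h1 h2)

theorem fork_even (S : CurrentSystem adj fork x t h) (e e' : Sgn) {i j : I}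
    (hf : fork i j) : ∀ r s : ℕ, Even (r + s) → ⁅x e i r, x e' j s⁆ = 0
  | 0, 0, _ => S.fork_zero_zero e e' hf
  | 1, 1, _ => S.fork_one_one e e' hf
  | 0, 1, hrs => absurd hrs (by decide)
  | 1, 0, hrs => absurd hrs (by decide)
  | r + 2, s, hrs => (S.fork_add_two hf (S.fork_even e e' hf r s (by
      rw [Nat.even_iff] at hrs ⊢; omega))).1
  | 0, s + 2, hrs => (S.fork_add_two hf (S.fork_even e e' hf 0 s (by
      rw [Nat.even_iff] at hrs ⊢; omega))).2
  | 1, s + 2, hrs => (S.fork_add_two hf (S.fork_even e e' hf 1 s (by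
      rw [Nat.even_iff] at hrs ⊢; omega))).2

/-- As t_i raises both nodes with coefficients of equal size, applying it to a vanishing even
bracket relates the two neighbouring odd ones. For equal signs this is the source of ε = -1 in the
shift relation. -/
theorem fork_shift (S : CurrentSystem adj fork x t h) (e e' : Sgn) {i j : I}
    (hf : fork i j) (r s : ℕ) :
    e.toC • ⁅x e i (r + 1), x e' j s⁆ = (-e'.toC) • ⁅x e i r, x e' j (s + 1)⁆ := by
  by_cases hrs : Even (r + s)
  · have e1 := lie_lie_of_shift (fun u => S.t_self e i u) (fun u => S.t_fork e' u hf) r s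
    rw [S.fork_even e e' hf r s hrs, lie_zero] at e1
    linear_combination (norm := module) (-1 / 2 : ℂ) • e1
  · rw [S.fork_even e e' hf (r + 1) s (by rw [Nat.even_iff] at *; omega),
      S.fork_even e e' hf r (s + 1) (by rw [Nat.even_iff] at *; omega), smul_zero, smul_zero]

theorem fork_shift_same (S : CurrentSystem adj fork x t h) (e : Sgn) {i j : I}
    (hf : fork i j) (r s : ℕ) : ⁅x e i (r + 1), x e j s⁆ = -⁅x e i r, x e j (s + 1)⁆ := by
  have := S.fork_shift e e hf r s
  cases e
  · simpa [Sgn.toC] using this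
  · simp only [Sgn.toC] at this
    linear_combination (norm := module) -this

theorem fork_pos_neg (S : CurrentSystem adj fork x t h) {i j : I} (hf : fork i j) (r s : ℕ) :
    ⁅x .pos i r, x .neg j s⁆ = ⁅x .pos i (r + s), x .neg j 0⁆ := by
  induction s generalizing r with
  | zero => rfl
  | succ s ih =>
    have := S.fork_shift .pos .neg hf r s
    simp only [Sgn.toC, neg_neg, one_smul] at this
    rw [← this, ih, add_assoc, add_comm 1]

/-! ### Action of the coroots across a fork -/

theorem loopCoroot_fork_even (S : CurrentSystem adj fork x t h) (e : Sgn) {i j : I}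
    (hf : fork i j) {m : ℕ} (hm : Even m) (u : ℕ) :
    ⁅loopCoroot x i m, x e j u⁆ = (0 : ℂ) • x e j (u + m) := by
  refine S.loopCoroot_shift ?_ u
  rw [loopCoroot, lie_lie, S.fork_even _ _ hf m 0 hm, S.fork_zero_zero _ _ hf, lie_zero, lie_zero,
    sub_zero, zero_smul]

/-- The parity condition makes x^+_{i,a} and x^+_{j,r} commute, so only the bracket of x^-_j with
x^+_j contributes. -/
theorem lie_fork_pos (S : CurrentSystem adj fork x t h) {i j : I} (hf : fork i j) {a r : ℕ}
    (b : ℕ) (har : Even (a + r)) :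
    ⁅⁅x .pos i a, x .neg j b⁆, x .pos j r⁆ = ⁅loopCoroot x j (r + b), x .pos i a⁆ := by
  rw [lie_lie, S.fork_even _ _ hf a r har, lie_zero, sub_zero, ← lie_skew (x .neg j b), lie_neg,
    S.lie_pos_neg_self, lie_skew]

/-- The element [x^+_{j,0}, x^-_{i,2k+1}] equals [x^+_{j,2k}, x^-_{i,1}]. Bracketing with x^+_{i,0}
turns the first form into K_{i,2k+1} acting on x^+_{j,0} and the second into t_i acting on
x^+_{j,2k}. -/
theorem loopCoroot_fork_odd_pos (S : CurrentSystem adj fork x t h) {i j : I}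
    (hf : fork i j) {m : ℕ} (hm : Odd m) (u : ℕ) :
    ⁅loopCoroot x i m, x .pos j u⁆ = (2 : ℂ) • x .pos j (u + m) := by
  refine S.loopCoroot_shift ?_ u
  have hf' := S.fork_symm hf
  obtain ⟨k, rfl⟩ := hm
  have e1 := S.lie_fork_pos hf' (a := 0) (r := 0) (2 * k + 1) (by simp)
  have e2 := S.lie_fork_pos hf' (a := 2 * k) (r := 0) 1 (by simp)
  rw [zero_add] at e1 e2
  rw [← e1, S.fork_pos_neg hf', zero_add, ← S.fork_pos_neg hf', e2, S.loopCoroot_one,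
    S.t_fork _ _ hf]
  simp [Sgn.toC]

theorem loopCoroot_fork_odd (S : CurrentSystem adj fork x t h) (e : Sgn) {i j : I}
    (hf : fork i j) {m : ℕ} (hm : Odd m) (u : ℕ) :
    ⁅loopCoroot x i m, x e j u⁆ = (2 * e.toC) • x e j (u + m) := by
  cases e
  · rw [S.loopCoroot_fork_odd_pos hf hm]; simp [Sgn.toC]
  · have := S.flip.loopCoroot_fork_odd_pos hf hm u
    rw [S.loopCoroot_flip, neg_lie] at this
    simp only [Sgn.flip] at this
    simp only [Sgn.toC]
    linear_combination (norm := module) -this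

theorem loopCoroot_loopCoroot (S : CurrentSystem adj fork x t h) (i j : I)
    (m k : ℕ) : ⁅loopCoroot x i m, loopCoroot x j k⁆ = 0 := by
  by_cases hf : fork i j
  · rcases Nat.even_or_odd m with hm | hm
    · exact S.lie_loopCoroot_eq_zero (c := 0) (k := m)
        (fun u => S.loopCoroot_fork_even _ hf hm u)
        (fun u => by rw [neg_zero]; exact S.loopCoroot_fork_even _ hf hm u) k
    · exact S.lie_loopCoroot_eq_zero (c := 2) (k := m)
        (fun u => by rw [S.loopCoroot_fork_odd _ hf hm]; simp [Sgn.toC])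
        (fun u => by rw [S.loopCoroot_fork_odd _ hf hm]; simp [Sgn.toC]) k
  · exact S.loopCoroot_comm hf m k

/-! ### The fork elements, which become the generators at -1 and n + 1 -/

theorem forkElt_pos (S : CurrentSystem adj fork x t h) {i j : I} (hf : fork i j) {m : ℕ}
    (hm : Odd m) (r : ℕ) :
    ⁅⁅x .pos i m, x .neg j 0⁆, x .pos j r⁆ = (2 : ℂ) • x .pos i (r + m) := by
  obtain ⟨k, rfl⟩ := hm
  -- The odd degree m is split as a + b with a ∈ {0, 1} of the parity of r, so that `lie_fork_pos`
  -- applies and r + b is odd.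
  rcases Nat.even_or_odd r with hr | hr
  · have := S.lie_fork_pos hf (a := 0) (r := r) (2 * k + 1) (by simpa using hr)
    rw [S.fork_pos_neg hf, zero_add] at this
    rw [this, S.loopCoroot_fork_odd_pos (S.fork_symm hf) (by
      rw [Nat.odd_iff]; rw [Nat.even_iff] at hr; omega), zero_add]
  · have := S.lie_fork_pos hf (a := 1) (r := r) (2 * k) (by
      rw [Nat.even_iff]; rw [Nat.odd_iff] at hr; omega)
    rw [S.fork_pos_neg hf, add_comm 1] at this
    rw [this, S.loopCoroot_fork_odd_pos (S.fork_symm hf) (by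
      rw [Nat.odd_iff] at *; omega)]
    congr 2; ring

/-- The Chevalley involution exchanges the fork elements of (i, j) and (j, i) up to sign; statements
about x^- follow from those about x^+. -/
theorem forkElt_flip (S : CurrentSystem adj fork x t h) {i j : I} (hf : fork i j) (m : ℕ) :
    ⁅x .neg i m, x .pos j 0⁆ = -⁅x .pos j m, x .neg i 0⁆ := by
  rw [← lie_skew, S.fork_pos_neg (S.fork_symm hf), zero_add]

theorem forkElt_neg (S : CurrentSystem adj fork x t h) {i j : I} (hf : fork i j) {m : ℕ}
    (hm : Odd m) (r : ℕ) :
    ⁅⁅x .pos i m, x .neg j 0⁆, x .neg i r⁆ = (-2 : ℂ) • x .neg j (r + m) := by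
  have := S.flip.forkElt_pos (S.fork_symm hf) hm r
  simp only [Sgn.flip] at this
  rw [S.forkElt_flip (S.fork_symm hf), neg_lie] at this
  linear_combination (norm := module) -this

/-- For odd m the degree on x^-_j can be taken as 0 or 1, of the parity of r; then x^+_{i,r}
commutes with both factors. -/
theorem pos_forkElt (S : CurrentSystem adj fork x t h) {i j : I} (hf : fork i j) (m : ℕ)
    (r : ℕ) : ⁅x .pos i r, ⁅x .pos i m, x .neg j 0⁆⁆ = 0 := by
  rcases Nat.even_or_odd m with hm | hm
  · rw [S.fork_even _ _ hf m 0 hm, lie_zero]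
  have key : ∀ a b, Even (r + b) → ⁅x .pos i r, ⁅x .pos i a, x .neg j b⁆⁆ = 0 := by
    intro a b hb
    rw [leibniz_lie, S.same_node, S.fork_even _ _ hf r b hb, lie_zero, zero_lie, add_zero]
  obtain ⟨k, rfl⟩ := hm
  rcases Nat.even_or_odd r with hr | hr
  · exact key _ 0 hr
  · have := key (2 * k) 1 (by rw [Nat.even_iff]; rw [Nat.odd_iff] at hr; omega)
    rwa [S.fork_pos_neg hf] at this

theorem neg_forkElt (S : CurrentSystem adj fork x t h) {i j : I} (hf : fork i j) (m : ℕ)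
    (r : ℕ) : ⁅x .neg j r, ⁅x .pos i m, x .neg j 0⁆⁆ = 0 := by
  have := S.flip.pos_forkElt (S.fork_symm hf) m r
  simp only [Sgn.flip] at this
  rwa [S.forkElt_flip (S.fork_symm hf), lie_neg, neg_eq_zero] at this

theorem forkElt_forkElt (S : CurrentSystem adj fork x t h) {i j : I} (hf : fork i j)
    (m k : ℕ) : ⁅⁅x .pos i m, x .neg j 0⁆, ⁅x .pos i k, x .neg j 0⁆⁆ = 0 := by
  rw [lie_lie, S.pos_forkElt hf, S.neg_forkElt hf, lie_zero, lie_zero, sub_zero]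

/-- The fork element, acting as a derivation on the zero bracket [x^+_{j,0}, x^-_{i,0}], produces
the difference of the two coroots. This is why D(2n) has no odd H at the nodes 0 and n. -/
theorem loopCoroot_eq_of_fork (S : CurrentSystem adj fork x t h) {i j : I} (hf : fork i j)
    {m : ℕ} (hm : Odd m) : loopCoroot x i m = loopCoroot x j m := by
  have e1 := S.forkElt_pos hf hm 0
  have e2 := S.forkElt_neg hf hm 0
  have e3 := leibniz_lie ⁅x .pos i m, x .neg j 0⁆ (x .pos j 0) (x .neg i 0)
  rw [S.fork_zero_zero _ _ (S.fork_symm hf), lie_zero, e1, e2, smul_lie, lie_smul, zero_add,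
    S.lie_pos_neg_self, S.lie_pos_neg_self, add_zero, zero_add] at e3
  linear_combination (norm := module) (-1 / 2 : ℂ) • e3

/-- The degree m can be moved from i to k, after which the bracket across the fork has degree zero
and vanishes. -/
theorem adj_forkElt_pos (S : CurrentSystem adj fork x t h) {i j k : I} (hf : fork i j)
    (hi : adj k i) (hj : adj k j) (r m : ℕ) : ⁅x .pos k r, ⁅x .pos i m, x .neg j 0⁆⁆ = 0 := by
  have h1 := S.lie_adj .pos hi
  rw [leibniz_lie, S.lie_pos_neg (S.adj_ne hj) (S.not_fork_of_adj hj), lie_zero, add_zero,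
    h1, ← zero_add (m + r), ← h1]
  have := leibniz_lie (x .pos k (m + r)) (x .pos i 0) (x .neg j 0)
  rw [S.fork_zero_zero _ _ hf, S.lie_pos_neg (S.adj_ne hj) (S.not_fork_of_adj hj), lie_zero,
    lie_zero, add_zero] at this
  exact this.symm

theorem adj_forkElt (S : CurrentSystem adj fork x t h) (e : Sgn) {i j k : I} (hf : fork i j)
    (hi : adj k i) (hj : adj k j) (r m : ℕ) : ⁅x e k r, ⁅x .pos i m, x .neg j 0⁆⁆ = 0 := by
  cases e
  · exact S.adj_forkElt_pos hf hi hj r m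
  · have := S.flip.adj_forkElt_pos (S.fork_symm hf) hj hi r m
    simp only [Sgn.flip] at this
    rwa [S.forkElt_flip (S.fork_symm hf), lie_neg, neg_eq_zero] at this

theorem far_forkElt (S : CurrentSystem adj fork x t h) (e : Sgn) {i j k : I} 
    (hi : k ≠ i) (hj : k ≠ j) (ai : ¬ adj k i) (aj : ¬ adj k j) (fi : ¬ fork k i)
    (fj : ¬ fork k j) (r m : ℕ) : ⁅x e k r, ⁅x .pos i m, x .neg j 0⁆⁆ = 0 := by
  rw [leibniz_lie]
  cases e
  · rw [S.lie_far _ hi ai fi, S.lie_pos_neg hj fj, lie_zero, zero_lie, zero_add]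
  · rw [S.lie_far _ hj aj fj, S.lie_neg_pos hi fi, lie_zero, zero_lie, zero_add]

/-- The inner bracket is -[x_{i,1}, x_{j,2r}], and x_{i,0} commutes with both of its factors. -/
theorem serre_fork (S : CurrentSystem adj fork x t h) (e : Sgn) {i j : I} (hf : fork i j)
    (r : ℕ) : ⁅x e i 0, ⁅x e i 0, x e j (2 * r + 1)⁆⁆ = 0 := by
  have e1 := S.fork_shift_same e hf 0 (2 * r)
  rw [zero_add] at e1
  rw [← neg_neg ⁅x e i 0, x e j (2 * r + 1)⁆, ← e1, lie_neg, leibniz_lie, S.same_node,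
    S.fork_even _ _ hf 0 (2 * r) (by simp), lie_zero, zero_lie, add_zero, neg_zero]

end CurrentSystem

end Lie

attribute [local instance] LieRing.ofAssociativeRing

/-! ### The system of elements in the minimalistic algebra -/

/-- The node `k` with `1 ≤ k ≤ n-1` in whose column the node `i` lies in odd degree. -/
def foldNode (n : ℕ) (i : ℤ) : ℤ := if i = 0 then 1 else if i = n then (n : ℤ) - 1 else i

/-! ### Entries of the even and odd Cartan matrices -/

theorem cartanOdd_fold_self (n : ℕ) (i : ℤ) :
    cartanOdd n (foldNode n i) i = 2 := by
  unfold cartanOdd foldNode cartanEven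
  grind

theorem cartanOdd_fold_adj {n : ℕ} (hn : 4 ≤ n) {i j : ℤ}
    (hj : 0 ≤ j ∧ j ≤ (n : ℤ)) (ha : cartanEven n i j = -1) :
    cartanOdd n (foldNode n i) j = -1 := by
  unfold cartanOdd foldNode cartanEven
  unfold cartanEven at ha
  grind

theorem cartanOdd_fold_fork {n : ℕ} (hn : 4 ≤ n) {i j : ℤ} (hf : IsFork n i j) :
    cartanOdd n (foldNode n i) j = 2 := by
  unfold cartanOdd foldNode cartanEven
  rcases hf with ⟨rfl, rfl⟩ | ⟨rfl, rfl⟩ | ⟨rfl, rfl⟩ | ⟨rfl, rfl⟩ <;> grind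

theorem cartanOdd_fold_far {n : ℕ} (hn : 4 ≤ n) {i j : ℤ}
    (hj : 0 ≤ j ∧ j ≤ (n : ℤ)) (hij : i ≠ j) (ha : cartanEven n i j ≠ -1)
    (hf : ¬ IsFork n i j) : cartanOdd n (foldNode n i) j = 0 := by
  unfold cartanOdd foldNode cartanEven
  unfold cartanEven at ha
  unfold IsFork at hf
  grind

theorem cartanEven_far {n : ℕ} {i j : ℤ} (hij : i ≠ j) (ha : cartanEven n i j ≠ -1) :
    cartanEven n i j = 0 := by
  unfold cartanEven at *
  grind

theorem cartanEven_symm (n : ℕ) (i j : ℤ) : cartanEven n i j = cartanEven n j i := by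
  unfold cartanEven
  grind

theorem IsFork.symm {n : ℕ} {i j : ℤ} (hf : IsFork n i j) : IsFork n j i := by
  unfold IsFork at *; omega

theorem IsFork.ne {n : ℕ} {i j : ℤ} (hf : IsFork n i j) : i ≠ j := by
  unfold IsFork at *; omega

theorem IsFork.cartanEven_eq {n : ℕ} (hn : 4 ≤ n) {i j : ℤ} (hf : IsFork n i j) :
    cartanEven n i j = 0 := by
  unfold IsFork at *; unfold cartanEven; grind

theorem exists_cartanEven_eq_neg_one {n : ℕ} (hn : 4 ≤ n) {i : ℤ} (hi : 0 ≤ i ∧ i ≤ (n : ℤ)) :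
    ∃ j : ℤ, (0 ≤ j ∧ j ≤ (n : ℤ)) ∧ cartanEven n i j = -1 := by
  by_cases h1 : i ≤ 1
  · exact ⟨2, by omega, by unfold cartanEven; grind⟩
  by_cases h2 : i ≤ (n : ℤ) - 2
  · exact ⟨i + 1, by omega, by unfold cartanEven; grind⟩
  · exact ⟨(n : ℤ) - 2, by omega, by unfold cartanEven; grind⟩

theorem exists_cartanEven_fork {n : ℕ} (hn : 4 ≤ n) {i j : ℤ} (hf : IsFork n i j) :
    ∃ k : ℤ, (0 ≤ k ∧ k ≤ (n : ℤ)) ∧ cartanEven n k i = -1 ∧ cartanEven n k j = -1 := by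
  unfold IsFork at hf
  by_cases h1 : i ≤ 1
  · exact ⟨2, by omega, by unfold cartanEven; grind, by unfold cartanEven; grind⟩
  · exact ⟨(n : ℤ) - 2, by omega, by unfold cartanEven; grind,
      by unfold cartanEven; grind⟩

/-! ### Naturality of the loop element -/

section LoopMap

variable {L M : Type} [LieRing L] [LieAlgebra ℂ L] [LieRing M] [LieAlgebra ℂ M]

theorem map_rootVector (f : L →ₗ⁅ℂ⁆ M) (n : ℕ) (x : ℤ → L) :
    f (rootVector n x) = rootVector n (fun i => f (x i)) := by
  unfold rootVector
  rw [map_zsmul]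
  congr 1
  induction rootWord n with
  | nil => rfl
  | cons a l ih => rw [List.foldr_cons, List.foldr_cons, LieHom.map_lie, ih]

theorem map_halfAdIter (f : L →ₗ⁅ℂ⁆ M) (h e : L) (k : ℕ) :
    f (halfAdIter h e k) = halfAdIter (f h) (f e) k := by
  induction k with
  | zero => rfl
  | succ k ih => rw [halfAdIter, halfAdIter, map_smul, LieHom.map_lie, ih]

theorem map_loopCartan (f : L →ₗ⁅ℂ⁆ M) (n : ℕ) (xp xm : ℤ → L) (u : ℤ) :
    f (loopCartan n xp xm u) = loopCartan n (fun i => f (xp i)) (fun i => f (xm i)) u := by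
  unfold loopCartan
  rw [LieHom.map_lie, map_halfAdIter]
  split_ifs <;> simp only [LieHom.map_lie, map_rootVector]

end LoopMap

/-! ### Solutions of the minimalistic relations are current systems -/

section MinRepresentation

variable {n : ℕ} {L : Type} [LieRing L] [LieAlgebra ℂ L] {p : MinFree n →ₗ⁅ℂ⁆ L}

theorem zsmul_eq_csmul (k : ℤ) (y : L) :
    k • y = (k : ℂ) • y := (Int.cast_smul_eq_zsmul ℂ k y).symm

/-- The elements `x^±_{i,r}` for all `r`, in the image of a homomorphism `p`. -/
noncomputable def minX (p : MinFree n →ₗ⁅ℂ⁆ L) (e : Sgn) (i : ℤ) : ℕ → L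
  | 0 => p (MinFree.x n e i 0)
  | r + 1 => (e.toC / 2) • ⁅p (MinFree.h n (foldNode n i) 1), minX p e i r⁆

theorem minH_minX_zero (hp : ∀ a b, MinRel n a b → p a = p b)
    {k j : ℤ} {r : ℕ} (e : Sgn) (hk : ValidMinH n k r)
    (hj : 0 ≤ j ∧ j ≤ (n : ℤ)) :
    ⁅p (MinFree.h n k r), p (MinFree.x n e j 0)⁆ =
      (e.toC * (cartan n r k j : ℤ)) •
      p (MinFree.x n e j r) := by
  have := hp _ _ (MinRel.hx e k j r hk hj)
  rw [LieHom.map_lie, map_zsmul] at this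
  rw [this, zsmul_eq_csmul, Sgn.toC_eq_toInt]
  push_cast
  rfl

theorem foldNode_valid (hn : 4 ≤ n) {i : ℤ} (hi : 0 ≤ i ∧ i ≤ (n : ℤ)) :
    1 ≤ foldNode n i ∧ foldNode n i ≤ (n : ℤ) - 1 := by
  unfold foldNode; grind

/-- The recursion overwrites nothing: in degree one it returns the given generator, because the
relevant entry of the odd matrix is 2. -/
theorem minX_one (hp : ∀ a b, MinRel n a b → p a = p b)
    (hn : 4 ≤ n) (e : Sgn) {i : ℤ} (hi : 0 ≤ i ∧ i ≤ (n : ℤ)) :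
    minX p e i 1 = p (MinFree.x n e i 1) := by
  obtain ⟨h1, h2⟩ := foldNode_valid hn hi
  rw [minX, minX, minH_minX_zero hp e (Or.inr ⟨h1, h2, rfl⟩) hi, cartan, if_neg (by decide),
    cartanOdd_fold_self]
  cases e <;> simp only [Sgn.toC] <;> push_cast <;> module

theorem minH_comm (hp : ∀ a b, MinRel n a b → p a = p b)
    {i j : ℤ} {r s : ℕ} (hi : ValidMinH n i r) (hj : ValidMinH n j s) :
    ⁅p (MinFree.h n i r), p (MinFree.h n j s)⁆ = 0 := by
  have := hp _ _ (MinRel.hh i j r s hi hj)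
  rwa [LieHom.map_lie, map_zero] at this

/-- The relations give this only on degree zero; it climbs the recursion because the degree-one
Cartan elements commute. -/
theorem minH_one_minX (hp : ∀ a b, MinRel n a b → p a = p b)
    (hn : 4 ≤ n) {k j : ℤ} (e : Sgn) (hk : 1 ≤ k ∧ k ≤ (n : ℤ) - 1)
    (hj : 0 ≤ j ∧ j ≤ (n : ℤ)) (r : ℕ) :
    ⁅p (MinFree.h n k 1), minX p e j r⁆ = (e.toC * (cartanOdd n k j : ℤ)) • minX p e j (r + 1) := by
  have hkv : ValidMinH n k 1 := Or.inr ⟨hk.1, hk.2, rfl⟩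
  have hjv : ValidMinH n (foldNode n j) 1 :=
    Or.inr ⟨(foldNode_valid hn hj).1, (foldNode_valid hn hj).2, rfl⟩
  induction r with
  | zero =>
    rw [zero_add, minX_one hp hn e hj, minX, minH_minX_zero hp e hkv hj, cartan, if_neg (by decide)]
  | succ r ih =>
    rw [minX, lie_smul, leibniz_lie, minH_comm hp hkv hjv, zero_lie, zero_add, ih, lie_smul,
      smul_comm]
    rfl

theorem minH_zero_minX (hp : ∀ a b, MinRel n a b → p a = p b)
    (hn : 4 ≤ n) {k j : ℤ} (e : Sgn) (hk : 0 ≤ k ∧ k ≤ (n : ℤ))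
    (hj : 0 ≤ j ∧ j ≤ (n : ℤ)) (r : ℕ) :
    ⁅p (MinFree.h n k 0), minX p e j r⁆ = (e.toC * (cartanEven n k j : ℤ)) • minX p e j r := by
  have hkv : ValidMinH n k 0 := Or.inl ⟨hk.1, hk.2, rfl⟩
  have hjv : ValidMinH n (foldNode n j) 1 :=
    Or.inr ⟨(foldNode_valid hn hj).1, (foldNode_valid hn hj).2, rfl⟩
  induction r with
  | zero => rw [minX, minH_minX_zero hp e hkv hj, cartan, if_pos (by decide)]
  | succ r ih =>
    rw [minX, lie_smul, leibniz_lie, minH_comm hp hkv hjv, zero_lie, zero_add, ih, lie_smul,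
      smul_comm]

/-- The nodes `0, …, n`. -/
abbrev Node (n : ℕ) : Type := {i : ℤ // 0 ≤ i ∧ i ≤ (n : ℤ)}

theorem min_pos_one_neg (hp : ∀ a b, MinRel n a b → p a = p b) {i : ℤ} (hi : 0 ≤ i ∧ i ≤ (n : ℤ)) :
    ⁅p (MinFree.x n .pos i 1), p (MinFree.x n .neg i 0)⁆ = p (MinFree.h n (foldNode n i) 1) := by
  unfold foldNode
  split_ifs with h1 h2
  · subst h1; simpa only [LieHom.map_lie] using hp _ _ MinRel.xx_one_zero
  · subst h2; simpa only [LieHom.map_lie] using hp _ _ MinRel.xx_one_last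
  · simpa only [LieHom.map_lie] using
      hp _ _ (MinRel.xx_one_mid i (by omega))

theorem min_currentSystem (hp : ∀ a b, MinRel n a b → p a = p b)
    (hn : 4 ≤ n) :
    CurrentSystem (fun i j : Node n => cartanEven n i j = -1) (fun i j : Node n => IsFork n i j)
      (fun e i r => minX p e i r) (fun i => p (MinFree.h n (foldNode n i) 1))
      (fun i => p (MinFree.h n i 0)) where
  adj_symm {i j} ha := by rw [cartanEven_symm]; exact ha
  fork_symm hf := hf.symm
  adj_ne {i j} ha hij := by
    subst hij
    simp [cartanEven] at ha
  fork_ne {i j} hf hij := hf.ne (congrArg Subtype.val hij)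
  not_fork_of_adj {i j} ha hf := by rw [hf.cartanEven_eq hn] at ha; omega
  exists_adj i := by
    obtain ⟨j, hj, ha⟩ := exists_cartanEven_eq_neg_one hn i.2
    exact ⟨⟨j, hj⟩, ha⟩
  exists_adj_fork hf := by
    obtain ⟨k, hk, ha⟩ := exists_cartanEven_fork hn hf
    exact ⟨⟨k, hk⟩, ha⟩
  t_self e i r := by
    rw [minH_one_minX hp hn e (foldNode_valid hn i.2) i.2, cartanOdd_fold_self]
    push_cast
    rw [mul_comm]
  t_adj e i j r ha := by
    rw [minH_one_minX hp hn e (foldNode_valid hn i.2) j.2, cartanOdd_fold_adj hn j.2 ha]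
    push_cast
    rw [mul_neg_one]
  t_fork e i j r hf := by
    rw [minH_one_minX hp hn e (foldNode_valid hn i.2) j.2, cartanOdd_fold_fork hn hf]
    push_cast
    rw [mul_comm]
  t_far e i j r hij ha hf := by
    rw [minH_one_minX hp hn e (foldNode_valid hn i.2) j.2,
      cartanOdd_fold_far hn j.2 (fun H => hij (Subtype.ext H)) ha hf]
    simp
  t_t i j := minH_comm hp (Or.inr ⟨(foldNode_valid hn i.2).1, (foldNode_valid hn i.2).2, rfl⟩)
    (Or.inr ⟨(foldNode_valid hn j.2).1, (foldNode_valid hn j.2).2, rfl⟩)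
  t_h i j := minH_comm hp (Or.inr ⟨(foldNode_valid hn i.2).1, (foldNode_valid hn i.2).2, rfl⟩)
    (Or.inl ⟨j.2.1, j.2.2, rfl⟩)
  h_self e i r := by
    rw [minH_zero_minX hp hn e i.2 i.2, cartanEven, if_pos rfl]
    push_cast
    rw [mul_comm]
  h_adj e i j r ha := by
    rw [minH_zero_minX hp hn e i.2 j.2, ha]
    push_cast
    rw [mul_neg_one]
  h_far e i j r hij ha := by
    rw [minH_zero_minX hp hn e i.2 j.2, cartanEven_far (fun H => hij (Subtype.ext H)) ha]
    simp
  pos_neg i := by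
    simpa only [LieHom.map_lie, minX] using hp _ _ (MinRel.xx_same i.1 i.2)
  pos_one_neg i := by
    rw [minX_one hp hn _ i.2]; exact min_pos_one_neg hp i.2
  pos_neg_ne {i j} hij := by
    simpa only [LieHom.map_lie, map_zero, minX] using
      hp _ _ (MinRel.xx_diff i.1 j.1 i.2 j.2 (fun H => hij (Subtype.ext H)))
  one_zero e i := by
    rw [minX_one hp hn _ i.2]
    simpa only [LieHom.map_lie, map_zero, minX] using
      hp _ _ (MinRel.same_node e i.1 i.2)
  serre_two e i j hij ha := by
    simpa only [LieHom.map_lie, map_zero, minX] using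
      hp _ _ (MinRel.serre_two e i.1 j.1 i.2 j.2 (by
        rw [cartan, if_pos (by decide)]
        exact cartanEven_far (fun H => hij (Subtype.ext H)) ha))
  serre_three e i j ha := by
    simpa only [LieHom.map_lie, map_zero, minX] using
      hp _ _ (MinRel.serre_three e i.1 j.1 i.2 j.2 (by
        rw [cartan, if_pos (by decide)]; exact ha))
  fork_rel {i j} hf := by
    obtain ⟨i, hi⟩ := i
    obtain ⟨j, hj⟩ := j
    have h1 : ∀ e, ⁅⁅p (MinFree.x n .pos ((n : ℤ) - 1) 1), p (MinFree.x n .neg ((n : ℤ) - 1) 1)⁆,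
        p (MinFree.x n e n 0)⁆ = 0 := fun e => by
      simpa only [LieHom.map_lie, map_zero] using hp _ _ (MinRel.fork_last e)
    have h2 : ∀ e, ⁅⁅p (MinFree.x n .pos 0 1), p (MinFree.x n .neg 0 1)⁆, p (MinFree.x n e 1 0)⁆ =
        0 := fun e => by
      simpa only [LieHom.map_lie, map_zero] using hp _ _ (MinRel.fork_zero e)
    simp only [minX_one hp hn _ hi, minX_one hp hn _ hj]
    -- The relations are imposed with the coroot at node 0 and at node n - 1, so the order of the
    -- pair decides the alternative.
    rcases hf with ⟨rfl, rfl⟩ | ⟨rfl, rfl⟩ | ⟨rfl, rfl⟩ | ⟨rfl, rfl⟩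
    · exact Or.inl h2
    · exact Or.inr h2
    · exact Or.inl h1
    · exact Or.inr h1

end MinRepresentation

/-! ### The relations of D(2n) in the minimalistic algebra -/

section Extension

variable {n : ℕ} {L : Type} [LieRing L] [LieAlgebra ℂ L] {p : MinFree n →ₗ⁅ℂ⁆ L}

/-- The images of the generators `X^±_{i,r}` of `D(2n)`. -/
noncomputable def genX (p : MinFree n →ₗ⁅ℂ⁆ L) (e : Sgn) (i : ℤ) (r : ℕ) : L :=
  if i = -1 then
    match e with
    | .pos => -⁅minX p .pos 0 r, minX p .neg 1 0⁆
    | .neg => -⁅minX p .pos 1 r, minX p .neg 0 0⁆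
  else if i = n + 1 then
    match e with
    | .pos => -⁅minX p .pos n r, minX p .neg ((n : ℤ) - 1) 0⁆
    | .neg => -⁅minX p .pos ((n : ℤ) - 1) r, minX p .neg n 0⁆
  else minX p e i r

/-- The images of the generators of `D(2n)`. -/
noncomputable def genImage (p : MinFree n →ₗ⁅ℂ⁆ L) : DGen n → L
  | .H i r _ => loopCoroot (minX p) i r
  | .X e i r _ => genX p e i r

/-- The homomorphism from the free Lie algebra on the generators of `D(2n)`. -/
noncomputable def freeLift (p : MinFree n →ₗ⁅ℂ⁆ L) : DFree n →ₗ⁅ℂ⁆ L :=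
  FreeLieAlgebra.lift ℂ (genImage p)

theorem freeLift_H {i : ℤ} {r : ℕ} (hv : ValidH n i r) :
    freeLift p (DFree.H n i r) = loopCoroot (minX p) i r := by
  rw [DFree.H, dif_pos hv, freeLift, FreeLieAlgebra.lift_of_apply]; rfl

theorem freeLift_X_of_valid (e : Sgn) {i : ℤ} {r : ℕ} (hv : ValidX n i r) :
    freeLift p (DFree.X n e i r) = genX p e i r := by
  rw [DFree.X, dif_pos hv, freeLift, FreeLieAlgebra.lift_of_apply]; rfl

theorem freeLift_X (e : Sgn) {i : ℤ} (hi : 0 ≤ i ∧ i ≤ (n : ℤ)) (r : ℕ) :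
    freeLift p (DFree.X n e i r) = minX p e i r := by
  rw [freeLift_X_of_valid e (Or.inl hi)]
  unfold genX
  rw [if_neg (by omega), if_neg (by omega)]

theorem freeLift_X_start_pos {r : ℕ} (hr : Odd r) :
    freeLift p (DFree.X n .pos (-1) r) = -⁅minX p .pos 0 r, minX p .neg 1 0⁆ := by
  rw [freeLift_X_of_valid _ (Or.inr ⟨Or.inl rfl, hr⟩), genX, if_pos rfl]

theorem freeLift_X_start_neg {r : ℕ} (hr : Odd r) :
    freeLift p (DFree.X n .neg (-1) r) = -⁅minX p .pos 1 r, minX p .neg 0 0⁆ := by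
  rw [freeLift_X_of_valid _ (Or.inr ⟨Or.inl rfl, hr⟩), genX, if_pos rfl]

theorem freeLift_X_end_pos {r : ℕ} (hr : Odd r) :
    freeLift p (DFree.X n .pos ((n : ℤ) + 1) r) =
      -⁅minX p .pos n r, minX p .neg ((n : ℤ) - 1) 0⁆ := by
  rw [freeLift_X_of_valid _ (Or.inr ⟨Or.inr rfl, hr⟩), genX, if_neg (by omega), if_pos rfl]

theorem freeLift_X_end_neg {r : ℕ} (hr : Odd r) :
    freeLift p (DFree.X n .neg ((n : ℤ) + 1) r) =
      -⁅minX p .pos ((n : ℤ) - 1) r, minX p .neg n 0⁆ := by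
  rw [freeLift_X_of_valid _ (Or.inr ⟨Or.inr rfl, hr⟩), genX, if_neg (by omega), if_pos rfl]

/-- Stated for every integer i because the loop element takes functions on ℤ. Outside 0, …, n both
sides are the default value 0; the nodes -1 and n + 1 carry only odd degrees. -/
theorem freeLift_X_zero (e : Sgn) (i : ℤ) :
    freeLift p (DFree.X n e i 0) = p (MinFree.x n e i 0) := by
  by_cases hi : 0 ≤ i ∧ i ≤ (n : ℤ)
  · rw [freeLift_X e hi, minX]
  · rw [DFree.X, dif_neg (fun H => H.elim hi (fun H => by simp at H)), MinFree.x,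
      dif_neg (fun H => hi ⟨H.1, H.2.1⟩), map_zero, map_zero]

/-- A form common to both signs, so that relations not depending on the sign are checked once. -/
theorem freeLift_X_start (hn : 4 ≤ n) (e : Sgn) :
    ∃ i j : Node n, IsFork n i j ∧ i.1 ≤ 1 ∧ j.1 ≤ 1 ∧ ∀ r, Odd r →
      freeLift p (DFree.X n e (-1) r) = -⁅minX p .pos i r, minX p .neg j 0⁆ := by
  cases e
  · exact ⟨⟨0, by omega⟩, ⟨1, by omega⟩, by simp [IsFork], by simp, by simp,
      fun r hr => freeLift_X_start_pos hr⟩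
  · exact ⟨⟨1, by omega⟩, ⟨0, by omega⟩, by simp [IsFork], by simp, by simp,
      fun r hr => freeLift_X_start_neg hr⟩

theorem freeLift_X_end (hn : 4 ≤ n) (e : Sgn) :
    ∃ i j : Node n, IsFork n i j ∧ (n : ℤ) - 1 ≤ i.1 ∧ (n : ℤ) - 1 ≤ j.1 ∧ ∀ r, Odd r →
      freeLift p (DFree.X n e ((n : ℤ) + 1) r) = -⁅minX p .pos i r, minX p .neg j 0⁆ := by
  cases e
  · exact ⟨⟨n, by omega⟩, ⟨(n : ℤ) - 1, by omega⟩, by simp [IsFork], by simp, by simp,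
      fun r hr => freeLift_X_end_pos hr⟩
  · exact ⟨⟨(n : ℤ) - 1, by omega⟩, ⟨n, by omega⟩, by simp [IsFork], by simp, by simp,
      fun r hr => freeLift_X_end_neg hr⟩

theorem validH_node (hn : 4 ≤ n) {i : ℤ} {r : ℕ} (hv : ValidH n i r) : 0 ≤ i ∧ i ≤ (n : ℤ) := by
  unfold ValidH at hv; omega

theorem loopCoroot_minX (hp : ∀ a b, MinRel n a b → p a = p b) (hn : 4 ≤ n) (e : Sgn) {i j : ℤ}
    {r : ℕ} (hv : ValidH n i r) (hj : 0 ≤ j ∧ j ≤ (n : ℤ)) (s : ℕ) :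
    ⁅loopCoroot (minX p) i r, minX p e j s⁆ =
      (e.toC * (cartan n r i j : ℤ)) • minX p e j (s + r) := by
  have S := min_currentSystem hp hn
  have hi := validH_node hn hv
  -- In odd degree only rows 1, …, n - 1 occur, and these are not folded.
  have hfold : Odd r → foldNode n i = i := by
    intro hr
    rcases hv with hv | hv
    · unfold foldNode; rw [if_neg (by omega), if_neg (by omega)]
    · exact absurd hr (Nat.not_odd_iff_even.2 hv.2)
  rcases eq_or_ne i j with rfl | hij
  · have hc : cartan n r i i = 2 := by
      unfold cartan
      split_ifs with hr
      · simp [cartanEven]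
      · have := cartanOdd_fold_self n i
        rwa [hfold (Nat.not_even_iff_odd.1 hr)] at this
    rw [hc, mul_comm]
    push_cast
    exact S.loopCoroot_self e ⟨i, hi⟩ r s
  by_cases ha : cartanEven n i j = -1
  · have hc : cartan n r i j = -1 := by
      unfold cartan
      split_ifs with hr
      · exact ha
      · have := cartanOdd_fold_adj hn hj ha
        rwa [hfold (Nat.not_even_iff_odd.1 hr)] at this
    rw [hc]
    push_cast
    rw [mul_neg_one]
    exact S.loopCoroot_adj e (i := ⟨i, hi⟩) (j := ⟨j, hj⟩) ha r s
  by_cases hf : IsFork n i j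
  · unfold cartan
    split_ifs with hr
    · rw [hf.cartanEven_eq hn, Int.cast_zero, mul_zero]
      exact S.loopCoroot_fork_even e (i := ⟨i, hi⟩) (j := ⟨j, hj⟩) hf hr s
    · rw [Nat.not_even_iff_odd] at hr
      have := cartanOdd_fold_fork hn hf
      rw [hfold hr] at this
      rw [this, mul_comm]
      push_cast
      exact S.loopCoroot_fork_odd e (i := ⟨i, hi⟩) (j := ⟨j, hj⟩) hf hr s
  · have hc : cartan n r i j = 0 := by
      unfold cartan
      split_ifs with hr
      · exact cartanEven_far hij ha
      · have := cartanOdd_fold_far hn hj hij ha hf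
        rwa [hfold (Nat.not_even_iff_odd.1 hr)] at this
    rw [hc, Int.cast_zero, mul_zero, zero_smul]
    exact S.loopCoroot_far e (i := ⟨i, hi⟩) (j := ⟨j, hj⟩)
      (fun H => hij (congrArg Subtype.val H)) ha hf r s

/-- The exceptional odd values at 0 and n are accounted for by the equality of odd coroots on a
fork. -/
theorem freeLift_coroot (hp : ∀ a b, MinRel n a b → p a = p b) (hn : 4 ≤ n) {i : ℤ}
    (hi : 0 ≤ i ∧ i ≤ (n : ℤ)) (m : ℕ) :
    freeLift p (DFree.coroot n i m) = loopCoroot (minX p) i m := by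
  have S := min_currentSystem hp hn
  unfold DFree.coroot
  split_ifs with h1 h2 h3
  · refine freeLift_H ?_
    by_cases h : 1 ≤ i ∧ i ≤ (n : ℤ) - 1
    · exact Or.inl h
    · exact Or.inr ⟨by omega, h1⟩
  · subst h2
    rw [freeLift_H (Or.inl (by omega))]
    exact S.loopCoroot_eq_of_fork (i := ⟨1, by omega⟩) (j := ⟨0, hi⟩) (by simp [IsFork])
      (Nat.not_even_iff_odd.1 h1)
  · subst h3
    rw [freeLift_H (Or.inl (by omega))]
    exact S.loopCoroot_eq_of_fork (i := ⟨(n : ℤ) - 1, by omega⟩) (j := ⟨n, hi⟩) (by simp [IsFork])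
      (Nat.not_even_iff_odd.1 h1)
  · exact freeLift_H (Or.inl (by omega))

/-- The bracket of `x^+_i` and `x^-_j` for a fork pair, compared with the additional generator. -/
theorem freeLift_negOdd (hp : ∀ a b, MinRel n a b → p a = p b) (hn : 4 ≤ n) {i j : Node n}
    (hf : IsFork n i j) {e : Sgn} {k : ℤ}
    (hk : ∀ r, Odd r → freeLift p (DFree.X n e k r) = -⁅minX p .pos i r, minX p .neg j 0⁆)
    (r s : ℕ) :
    ⁅minX p .pos i r, minX p .neg j s⁆ = freeLift p (DFree.negOdd n e k (r + s)) := by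
  have S := min_currentSystem hp hn
  unfold DFree.negOdd
  split_ifs with h
  · rw [map_neg, hk _ h, neg_neg]
    exact S.fork_pos_neg hf r s
  · rw [map_zero]
    exact S.fork_even .pos .neg hf r s (Nat.not_odd_iff_even.1 h)

theorem IsFork.cartanEven_left_eq {i j k : ℤ} (hn : 4 ≤ n) (hf : IsFork n i j) (hi : k ≠ i)
    (hj : k ≠ j) : cartanEven n k i = cartanEven n k j := by
  unfold cartanEven
  rcases hf with ⟨rfl, rfl⟩ | ⟨rfl, rfl⟩ | ⟨rfl, rfl⟩ | ⟨rfl, rfl⟩ <;> grind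

theorem IsFork.not_isFork {i j k : ℤ} (hn : 4 ≤ n) (hf : IsFork n i j) (hj : k ≠ j) :
    ¬ IsFork n k i := by
  unfold IsFork at *; omega

/-- A third node is adjacent to both members of a fork or to neither. -/
theorem minX_forkElt (hp : ∀ a b, MinRel n a b → p a = p b) (hn : 4 ≤ n) (e : Sgn)
    {i j k : Node n} (hf : IsFork n i j) (hi : k ≠ i) (hj : k ≠ j) (r s : ℕ) :
    ⁅minX p e k r, ⁅minX p .pos i s, minX p .neg j 0⁆⁆ = 0 := by
  have S := min_currentSystem hp hn
  have hi' : k.1 ≠ i.1 := fun H => hi (Subtype.ext H)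
  have hj' : k.1 ≠ j.1 := fun H => hj (Subtype.ext H)
  have hc := hf.cartanEven_left_eq hn hi' hj'
  by_cases ha : cartanEven n k i = -1
  · exact S.adj_forkElt e hf ha (hc.symm.trans ha) r s
  · exact S.far_forkElt e hi hj ha (hc ▸ ha) (hf.not_isFork hn hj') (hf.symm.not_isFork hn hi') r s

theorem freeLift_rel (hp : ∀ a b, MinRel n a b → p a = p b) (hn : 4 ≤ n) {a b : DFree n}
    (hab : DRel n a b) : freeLift p a = freeLift p b := by
  have S := min_currentSystem hp hn
  have g0 : (0 : ℤ) ≤ 0 ∧ (0 : ℤ) ≤ (n : ℤ) := by omega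
  have g1 : (0 : ℤ) ≤ 1 ∧ (1 : ℤ) ≤ (n : ℤ) := by omega
  have gM : (0 : ℤ) ≤ (n : ℤ) - 1 ∧ (n : ℤ) - 1 ≤ (n : ℤ) := by omega
  have gN : (0 : ℤ) ≤ (n : ℤ) ∧ (n : ℤ) ≤ (n : ℤ) := by omega
  let v0 : Node n := ⟨0, g0⟩
  let v1 : Node n := ⟨1, g1⟩
  let vM : Node n := ⟨(n : ℤ) - 1, gM⟩
  let vN : Node n := ⟨n, gN⟩
  have f01 : IsFork n v0 v1 := Or.inl ⟨rfl, rfl⟩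
  have f10 : IsFork n v1 v0 := f01.symm
  have fMN : IsFork n vM vN := Or.inr (Or.inr (Or.inl ⟨rfl, rfl⟩))
  have fNM : IsFork n vN vM := fMN.symm
  cases hab with
  | hh i j r s hi hj =>
    rw [LieHom.map_lie, freeLift_H hi, freeLift_H hj, map_zero]
    exact S.loopCoroot_loopCoroot ⟨i, validH_node hn hi⟩ ⟨j, validH_node hn hj⟩ r s
  | hx e i j r s hi hj =>
    rw [LieHom.map_lie, map_zsmul, freeLift_H hi, freeLift_X e hj, freeLift_X e hj,
      loopCoroot_minX hp hn e hi hj, zsmul_eq_csmul, Sgn.toC_eq_toInt, add_comm s]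
    push_cast
    rfl
  | xx_same i r s hi =>
    rw [LieHom.map_lie, freeLift_X _ hi, freeLift_X _ hi, freeLift_coroot hp hn hi]
    exact S.lie_pos_neg_self ⟨i, hi⟩ r s
  | xx_diff i j r s hi hj hij hf =>
    rw [LieHom.map_lie, freeLift_X _ hi, freeLift_X _ hj, map_zero]
    exact S.lie_pos_neg (i := ⟨i, hi⟩) (j := ⟨j, hj⟩) (fun H => hij (congrArg Subtype.val H)) hf r s
  | xx_pred_last r s =>
    rw [LieHom.map_lie, freeLift_X _ gM, freeLift_X _ gN]
    exact freeLift_negOdd hp hn fMN (fun r hr => freeLift_X_end_neg hr) r s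
  | xx_last_pred r s =>
    rw [LieHom.map_lie, freeLift_X _ gM, freeLift_X _ gN]
    exact freeLift_negOdd hp hn fNM (fun r hr => freeLift_X_end_pos hr) r s
  | xx_zero_one r s =>
    rw [LieHom.map_lie, freeLift_X _ g0, freeLift_X _ g1]
    exact freeLift_negOdd hp hn f01 (fun r hr => freeLift_X_start_pos hr) r s
  | xx_one_zero r s =>
    rw [LieHom.map_lie, freeLift_X _ g0, freeLift_X _ g1]
    exact freeLift_negOdd hp hn f10 (fun r hr => freeLift_X_start_neg hr) r s
  | end_far e f i r s hi hs =>
    obtain ⟨k, l, hf, hk, hl, hX⟩ := freeLift_X_end (p := p) hn f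
    have hi' : 0 ≤ i ∧ i ≤ (n : ℤ) := by omega
    rw [LieHom.map_lie, freeLift_X _ hi', hX s hs, lie_neg, map_zero, neg_eq_zero]
    exact minX_forkElt hp hn e (k := ⟨i, hi'⟩) hf (fun H => by subst H; simp at hk; omega)
      (fun H => by subst H; simp at hl; omega) r s
  | start_far e f i r s hi hr hs =>
    obtain ⟨k, l, hf, hk, hl, hX⟩ := freeLift_X_start (p := p) hn f
    have key : ∀ e (i : Node n), 2 ≤ i.1 → ∀ r,
        ⁅minX p e i r, ⁅minX p .pos k s, minX p .neg l 0⁆⁆ = 0 := fun e i hi r =>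
      minX_forkElt hp hn e hf (fun H => by subst H; omega) (fun H => by subst H; omega) r s
    rw [LieHom.map_lie, hX s hs, lie_neg, map_zero, neg_eq_zero]
    by_cases hi' : i ≤ n
    · rw [freeLift_X _ ⟨by omega, hi'⟩]
      exact key e ⟨i, by omega, hi'⟩ hi.1 r
    -- The element at n + 1 is a bracket of elements at the nodes n - 1 and n, each of which
    -- commutes with the element at -1 because n - 1 ≥ 2.
    · obtain rfl : i = (n : ℤ) + 1 := by omega
      obtain ⟨k', l', -, hk', hl', hX'⟩ := freeLift_X_end (p := p) hn e
      rw [hX' r (hr.elim (fun H => by omega) (fun H => H.2)), neg_lie, lie_lie,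
        key _ k' (by omega), key _ l' (by omega), lie_zero, lie_zero, sub_zero, neg_zero]
  | end_pred_pp r s hs =>
    rw [LieHom.map_lie, freeLift_X _ gM, freeLift_X_end_pos hs, map_zsmul, freeLift_X _ gN,
      zsmul_eq_csmul, lie_neg, lie_skew]
    exact S.forkElt_pos fNM hs r
  | end_pred_mp r s hs =>
    rw [LieHom.map_lie, freeLift_X _ gM, freeLift_X_end_pos hs, map_zero, lie_neg, neg_eq_zero]
    exact S.neg_forkElt fNM s r
  | end_pred_pm r s hs =>
    rw [LieHom.map_lie, freeLift_X _ gM, freeLift_X_end_neg hs, map_zero, lie_neg, neg_eq_zero]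
    exact S.pos_forkElt fMN s r
  | end_pred_mm r s hs =>
    rw [LieHom.map_lie, freeLift_X _ gM, freeLift_X_end_neg hs, map_zsmul, freeLift_X _ gN,
      zsmul_eq_csmul, lie_neg, lie_skew]
    push_cast
    exact S.forkElt_neg fMN hs r
  | end_last_pp r s hs =>
    rw [LieHom.map_lie, freeLift_X _ gN, freeLift_X_end_pos hs, map_zero, lie_neg, neg_eq_zero]
    exact S.pos_forkElt fNM s r
  | end_last_mp r s hs =>
    rw [LieHom.map_lie, freeLift_X _ gN, freeLift_X_end_pos hs, map_zsmul, freeLift_X _ gM,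
      zsmul_eq_csmul, lie_neg, lie_skew]
    push_cast
    exact S.forkElt_neg fNM hs r
  | end_last_pm r s hs =>
    rw [LieHom.map_lie, freeLift_X _ gN, freeLift_X_end_neg hs, map_zsmul, freeLift_X _ gM,
      zsmul_eq_csmul, lie_neg, lie_skew]
    exact S.forkElt_pos fMN hs r
  | end_last_mm r s hs =>
    rw [LieHom.map_lie, freeLift_X _ gN, freeLift_X_end_neg hs, map_zero, lie_neg, neg_eq_zero]
    exact S.neg_forkElt fMN s r
  | start_zero_pp r s hs =>
    rw [LieHom.map_lie, freeLift_X _ g0, freeLift_X_start_pos hs, map_zero, lie_neg, neg_eq_zero]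
    exact S.pos_forkElt f01 s r
  | start_zero_mp r s hs =>
    rw [LieHom.map_lie, freeLift_X _ g0, freeLift_X_start_pos hs, map_zsmul, freeLift_X _ g1,
      zsmul_eq_csmul, lie_neg, lie_skew]
    push_cast
    exact S.forkElt_neg f01 hs r
  | start_zero_pm r s hs =>
    rw [LieHom.map_lie, freeLift_X _ g0, freeLift_X_start_neg hs, map_zsmul, freeLift_X _ g1,
      zsmul_eq_csmul, lie_neg, lie_skew]
    exact S.forkElt_pos f10 hs r
  | start_zero_mm r s hs =>
    rw [LieHom.map_lie, freeLift_X _ g0, freeLift_X_start_neg hs, map_zero, lie_neg, neg_eq_zero]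
    exact S.neg_forkElt f10 s r
  | start_one_pp r s hs =>
    rw [LieHom.map_lie, freeLift_X _ g1, freeLift_X_start_pos hs, map_zsmul, freeLift_X _ g0,
      zsmul_eq_csmul, lie_neg, lie_skew]
    exact S.forkElt_pos f01 hs r
  | start_one_mp r s hs =>
    rw [LieHom.map_lie, freeLift_X _ g1, freeLift_X_start_pos hs, map_zero, lie_neg, neg_eq_zero]
    exact S.neg_forkElt f01 s r
  | start_one_pm r s hs =>
    rw [LieHom.map_lie, freeLift_X _ g1, freeLift_X_start_neg hs, map_zero, lie_neg, neg_eq_zero]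
    exact S.pos_forkElt f10 s r
  | start_one_mm r s hs =>
    rw [LieHom.map_lie, freeLift_X _ g1, freeLift_X_start_neg hs, map_zsmul, freeLift_X _ g0,
      zsmul_eq_csmul, lie_neg, lie_skew]
    push_cast
    exact S.forkElt_neg f10 hs r
  | same_node e i r s hr hs =>
    rw [LieHom.map_lie, map_zero]
    rcases hr with hi | ⟨hi, hr⟩
    · rw [freeLift_X _ hi, freeLift_X _ hi]
      exact S.same_node e ⟨i, hi⟩ r s
    · have hs' : Odd s := hs.elim (fun H => by omega) (fun H => H.2)
      rcases hi with rfl | rfl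
      · obtain ⟨k, l, hf, -, -, hX⟩ := freeLift_X_start (p := p) hn e
        rw [hX r hr, hX s hs', lie_neg, neg_lie, neg_neg]
        exact S.forkElt_forkElt hf r s
      · obtain ⟨k, l, hf, -, -, hX⟩ := freeLift_X_end (p := p) hn e
        rw [hX r hr, hX s hs', lie_neg, neg_lie, neg_neg]
        exact S.forkElt_forkElt hf r s
  | shift e i j r s hij hf =>
    have hi : 0 ≤ i ∧ i ≤ (n : ℤ) := by omega
    have hj : 0 ≤ j ∧ j ≤ (n : ℤ) := by omega
    rw [LieHom.map_lie, LieHom.map_lie, freeLift_X _ hi, freeLift_X _ hi, freeLift_X _ hj,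
      freeLift_X _ hj]
    -- For equal or distant nodes both sides vanish; only adjacent nodes carry content.
    rcases eq_or_ne i j with rfl | hne
    · exact (S.same_node e ⟨i, hi⟩ _ _).trans (S.same_node e ⟨i, hi⟩ _ _).symm
    by_cases ha : cartanEven n i j = -1
    · exact S.shift_adj e (i := ⟨i, hi⟩) (j := ⟨j, hj⟩) ha r s
    · have hne' : (⟨i, hi⟩ : Node n) ≠ ⟨j, hj⟩ := fun H => hne (congrArg Subtype.val H)
      exact (S.lie_far e hne' ha hf _ _).trans (S.lie_far e hne' ha hf _ _).symm
  | shift_zero_one e r s =>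
    rw [map_neg, LieHom.map_lie, LieHom.map_lie, freeLift_X _ g0, freeLift_X _ g0,
      freeLift_X _ g1, freeLift_X _ g1]
    exact S.fork_shift_same e f01 r s
  | shift_pred_last e r s =>
    rw [map_neg, LieHom.map_lie, LieHom.map_lie, freeLift_X _ gM, freeLift_X _ gM,
      freeLift_X _ gN, freeLift_X _ gN]
    exact S.fork_shift_same e fMN r s
  | serre_two e i j r s hi hj hij ha hf =>
    rw [LieHom.map_lie, freeLift_X _ hi, freeLift_X _ hj, map_zero]
    by_cases hf' : IsFork n i j
    · exact S.fork_even e e (i := ⟨i, hi⟩) (j := ⟨j, hj⟩) hf' r s (hf hf')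
    · rw [cartan, if_pos (by decide)] at ha
      exact S.lie_far e (i := ⟨i, hi⟩) (j := ⟨j, hj⟩) (fun H => hij (congrArg Subtype.val H))
        (by rw [ha]; decide) hf' r s
  | serre_three e i j r s u hi hj ha =>
    rw [LieHom.map_lie, LieHom.map_lie, freeLift_X _ hi, freeLift_X _ hi, freeLift_X _ hj,
      map_zero]
    rw [cartan, if_pos (by decide)] at ha
    exact S.serre_adj e (i := ⟨i, hi⟩) (j := ⟨j, hj⟩) ha r s u
  | serre_fork e i j r hf =>
    have hi : 0 ≤ i ∧ i ≤ (n : ℤ) := by unfold IsFork at hf; omega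
    have hj : 0 ≤ j ∧ j ≤ (n : ℤ) := by unfold IsFork at hf; omega
    rw [LieHom.map_lie, LieHom.map_lie, freeLift_X _ hi, freeLift_X _ hj, map_zero]
    exact S.serre_fork e (i := ⟨i, hi⟩) (j := ⟨j, hj⟩) hf r
  | loop u =>
    -- The loop element involves only degree-zero generators, so the relation is transported
    -- verbatim.
    have h1 := hp _ _ (MinRel.loop u)
    rw [map_sub, LieHom.map_lie, LieHom.map_lie, LieHom.map_lie, LieHom.map_lie, map_loopCartan,
      map_zero] at h1
    rw [map_sub, LieHom.map_lie, LieHom.map_lie, LieHom.map_lie, LieHom.map_lie, map_loopCartan,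
      map_zero]
    simp only [freeLift_X_zero, freeLift_X _ g1, minX_one hp hn _ g1]
    exact h1

end Extension

/-! ### The quotient map onto D(2n) -/

variable {n : ℕ}

/-- The projection of the free Lie algebra onto `D(2n)`. -/
noncomputable def dProj (n : ℕ) : DFree n →ₗ⁅ℂ⁆ D n :=
  { (LieSubmodule.Quotient.mk' (DIdeal n) : DFree n →ₗ[ℂ] D n) with
    map_lie' := fun {_ _} => rfl }

theorem dProj_surjective (n : ℕ) : Function.Surjective (dProj n) :=
  LieSubmodule.Quotient.surjective_mk' (DIdeal n)

theorem dProj_H (i : ℤ) (r : ℕ) : dProj n (DFree.H n i r) = D.H n i r := rfl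

theorem dProj_X (e : Sgn) (i : ℤ) (r : ℕ) : dProj n (DFree.X n e i r) = D.X n e i r := rfl

theorem dProj_rel {a b : DFree n} (hab : DRel n a b) : dProj n a = dProj n b := by
  rw [← sub_eq_zero, ← map_sub]
  refine (LieSubmodule.Quotient.mk_eq_zero (N := DIdeal n)).2 ?_
  exact LieSubmodule.subset_lieSpan ⟨a, b, hab, rfl⟩

/-! ### Generation in low degree -/

/-- The elements `H_{i,r}`, `X^±_{i,r}` of low degree. -/
def lowGenerators (n : ℕ) : Set (D n) :=
  {y | ∃ (i : ℤ) (r : ℕ), ValidMinH n i r ∧ y = D.H n i r} ∪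
    {y | ∃ (s : Sgn) (i : ℤ) (r : ℕ), ValidMinX n i r ∧ y = D.X n s i r}

theorem D_X_succ (hn : 4 ≤ n) (e : Sgn) {i : ℤ} (hi : 0 ≤ i ∧ i ≤ (n : ℤ)) (r : ℕ) :
    D.X n e i (r + 1) = (e.toC / 2) • ⁅D.H n (foldNode n i) 1, D.X n e i r⁆ := by
  have := dProj_rel (DRel.hx e (foldNode n i) i 1 r (Or.inl (foldNode_valid hn hi)) hi)
  rw [LieHom.map_lie, map_zsmul, dProj_H, dProj_X, dProj_X, cartan, if_neg (by decide),
    cartanOdd_fold_self, zsmul_eq_csmul] at this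
  rw [this, smul_smul, add_comm 1]
  cases e <;> simp [Sgn.toC, Sgn.toInt]

theorem D_X_mem (hn : 4 ≤ n) (e : Sgn) {i : ℤ} (hi : 0 ≤ i ∧ i ≤ (n : ℤ)) (r : ℕ) :
    D.X n e i r ∈ LieSubalgebra.lieSpan ℂ (D n) (lowGenerators n) := by
  induction r with
  | zero => exact LieSubalgebra.subset_lieSpan (Or.inr ⟨e, i, 0, ⟨hi.1, hi.2, Or.inl rfl⟩, rfl⟩)
  | succ r ih =>
    rw [D_X_succ hn e hi]
    obtain ⟨h1, h2⟩ := foldNode_valid hn hi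
    exact (LieSubalgebra.lieSpan ℂ (D n) (lowGenerators n)).smul_mem _
      (LieSubalgebra.lie_mem _ (LieSubalgebra.subset_lieSpan
        (Or.inl ⟨_, 1, Or.inr ⟨h1, h2, rfl⟩, rfl⟩)) ih)

/-- The coroot relation with s = 0 expresses H as a bracket of X's. Its exceptional odd values at 0
and n do not arise, since no such H is a generator. -/
theorem D_H_mem (hn : 4 ≤ n) {i : ℤ} {r : ℕ} (hv : ValidH n i r) :
    D.H n i r ∈ LieSubalgebra.lieSpan ℂ (D n) (lowGenerators n) := by
  have hi := validH_node hn hv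
  have := dProj_rel (DRel.xx_same i r 0 hi)
  have hc : DFree.coroot n i (r + 0) = DFree.H n i r := by
    unfold DFree.coroot
    rw [add_zero]
    split_ifs with h1 h2 h3
    · rfl
    · exact absurd (hv.resolve_left (by omega)).2 h1
    · exact absurd (hv.resolve_left (by omega)).2 h1
    · rfl
  rw [hc, LieHom.map_lie, dProj_H, dProj_X, dProj_X] at this
  rw [← this]
  exact LieSubalgebra.lie_mem _ (D_X_mem hn _ hi _) (D_X_mem hn _ hi _)

theorem D_X_mem_of_negOdd {e : Sgn} {i j k : ℤ} {r : ℕ} (hr : Odd r) (hn : 4 ≤ n)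
    (hi : 0 ≤ i ∧ i ≤ (n : ℤ)) (hj : 0 ≤ j ∧ j ≤ (n : ℤ))
    (hk : DRel n ⁅DFree.X n .pos i r, DFree.X n .neg j 0⁆ (DFree.negOdd n e k (r + 0))) :
    D.X n e k r ∈ LieSubalgebra.lieSpan ℂ (D n) (lowGenerators n) := by
  have := dProj_rel hk
  rw [add_zero, DFree.negOdd, if_pos hr, LieHom.map_lie, map_neg, dProj_X, dProj_X, dProj_X,
    eq_comm, neg_eq_iff_eq_neg] at this
  rw [this]
  exact neg_mem (LieSubalgebra.lie_mem _ (D_X_mem hn _ hi _) (D_X_mem hn _ hj _))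

theorem D_X_mem_of_valid (hn : 4 ≤ n) (e : Sgn) {i : ℤ} {r : ℕ} (hv : ValidX n i r) :
    D.X n e i r ∈ LieSubalgebra.lieSpan ℂ (D n) (lowGenerators n) := by
  rcases hv with hi | ⟨rfl | rfl, hr⟩
  · exact D_X_mem hn e hi r
  · cases e
    · exact D_X_mem_of_negOdd hr hn (by omega) (by omega) (DRel.xx_zero_one r 0)
    · exact D_X_mem_of_negOdd hr hn (by omega) (by omega) (DRel.xx_one_zero r 0)
  · cases e
    · exact D_X_mem_of_negOdd hr hn (by omega) (by omega) (DRel.xx_last_pred r 0)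
    · exact D_X_mem_of_negOdd hr hn (by omega) (by omega) (DRel.xx_pred_last r 0)

theorem dProj_of_mem (hn : 4 ≤ n) (g : DGen n) :
    dProj n (FreeLieAlgebra.of ℂ g) ∈ LieSubalgebra.lieSpan ℂ (D n) (lowGenerators n) := by
  cases g with
  | H i r hv =>
    have := D_H_mem hn hv
    rwa [← dProj_H, DFree.H, dif_pos hv] at this
  | X e i r hv =>
    have := D_X_mem_of_valid hn e hv
    rwa [← dProj_X, DFree.X, dif_pos hv] at this

/-- All generators map into the subalgebra, so the surjection from the free Lie algebra factors
through it. -/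
theorem lieSpan_lowGenerators (hn : 4 ≤ n) :
    LieSubalgebra.lieSpan ℂ (D n) (lowGenerators n) = ⊤ := by
  set K := LieSubalgebra.lieSpan ℂ (D n) (lowGenerators n) with hK
  let f : DFree n →ₗ⁅ℂ⁆ K := FreeLieAlgebra.lift ℂ fun g => ⟨dProj n (.of ℂ g), dProj_of_mem hn g⟩
  have hf : K.incl.comp f = dProj n := by
    refine FreeLieAlgebra.hom_ext fun g => ?_
    rw [LieHom.comp_apply, FreeLieAlgebra.lift_of_apply]
    rfl
  refine eq_top_iff.2 fun y _ => ?_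
  obtain ⟨a, rfl⟩ := dProj_surjective n y
  rw [← hf]
  exact (f a).2

/-- Two homomorphisms from `D(2n)` that agree on the generators of low degree are equal. -/
theorem D_hom_ext (hn : 4 ≤ n) {L : Type} [LieRing L] [LieAlgebra ℂ L] {f g : D n →ₗ⁅ℂ⁆ L}
    (hH : ∀ i r, ValidMinH n i r → f (D.H n i r) = g (D.H n i r))
    (hX : ∀ e i r, ValidMinX n i r → f (D.X n e i r) = g (D.X n e i r)) : f = g := by
  let E : LieSubalgebra ℂ (D n) :=
    { LinearMap.eqLocus (f : D n →ₗ[ℂ] L) (g : D n →ₗ[ℂ] L) with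
      lie_mem' := fun {a b} ha hb => by
        change f a = g a at ha
        change f b = g b at hb
        change f ⁅a, b⁆ = g ⁅a, b⁆
        rw [LieHom.map_lie, LieHom.map_lie, ha, hb] }
  have hE : LieSubalgebra.lieSpan ℂ (D n) (lowGenerators n) ≤ E := by
    rw [LieSubalgebra.lieSpan_le]
    rintro y (⟨i, r, hv, rfl⟩ | ⟨e, i, r, hv, rfl⟩)
    · exact hH i r hv
    · exact hX e i r hv
  rw [lieSpan_lowGenerators hn] at hE
  exact LieHom.ext fun y => hE (LieSubalgebra.mem_top y)

/-! ### The two homomorphisms -/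

/-- A homomorphism from the free Lie algebra that respects the relations descends to `D(2n)`. -/
noncomputable def dLift {L : Type} [LieRing L] [LieAlgebra ℂ L] (f : DFree n →ₗ⁅ℂ⁆ L)
    (hf : ∀ a b, DRel n a b → f a = f b) : D n →ₗ⁅ℂ⁆ L :=
  have hle : DIdeal n ≤ f.ker := by
    refine LieSubmodule.lieSpan_le.2 ?_
    rintro _ ⟨a, b, hab, rfl⟩
    exact f.mem_ker.2 (by rw [map_sub, hf a b hab, sub_self])
  { (DIdeal n).toSubmodule.liftQ (f : DFree n →ₗ[ℂ] L) (fun a ha => f.mem_ker.1 (hle ha)) with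
    map_lie' := fun {a b} => by
      obtain ⟨a, rfl⟩ := dProj_surjective n a
      obtain ⟨b, rfl⟩ := dProj_surjective n b
      exact f.map_lie a b }

theorem dLift_dProj {L : Type} [LieRing L] [LieAlgebra ℂ L] (f : DFree n →ₗ⁅ℂ⁆ L)
    (hf : ∀ a b, DRel n a b → f a = f b) (a : DFree n) : dLift f hf (dProj n a) = f a := rfl

/-- The projection of the free algebra onto `D̃(2n)`, as a homomorphism of Lie algebras. -/
noncomputable def minProj (n : ℕ) : MinFree n →ₗ⁅ℂ⁆ DMin n :=
  (RingQuot.mkAlgHom ℂ (MinRel n)).toLieHom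

theorem minProj_rel (a b : MinFree n) (hab : MinRel n a b) : minProj n a = minProj n b :=
  RingQuot.mkAlgHom_rel ℂ hab

theorem minProj_h (i : ℤ) (r : ℕ) : minProj n (MinFree.h n i r) = DMin.h n i r := rfl

theorem minProj_x (e : Sgn) (i : ℤ) (r : ℕ) : minProj n (MinFree.x n e i r) = DMin.x n e i r := rfl

/-- The homomorphism from `U(D(2n))` to `D̃(2n)`. -/
noncomputable def ofEnveloping (hn : 4 ≤ n) : UniversalEnvelopingAlgebra ℂ (D n) →ₐ[ℂ] DMin n :=
  UniversalEnvelopingAlgebra.lift ℂ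
    (dLift (freeLift (minProj n)) fun _ _ => freeLift_rel minProj_rel hn)

theorem ofEnveloping_X (hn : 4 ≤ n) (e : Sgn) {i : ℤ} {r : ℕ} (hv : ValidMinX n i r) :
    ofEnveloping hn (UniversalEnvelopingAlgebra.ι ℂ (D.X n e i r)) = DMin.x n e i r := by
  obtain ⟨h1, h2, rfl | rfl⟩ := hv
  all_goals rw [ofEnveloping, UniversalEnvelopingAlgebra.lift_ι_apply, ← dProj_X, dLift_dProj]
  · rw [freeLift_X_zero, minProj_x]
  · rw [freeLift_X e ⟨h1, h2⟩, minX_one minProj_rel hn e ⟨h1, h2⟩, minProj_x]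

theorem ofEnveloping_H (hn : 4 ≤ n) {i : ℤ} {r : ℕ} (hv : ValidMinH n i r) :
    ofEnveloping hn (UniversalEnvelopingAlgebra.ι ℂ (D.H n i r)) = DMin.h n i r := by
  have S := min_currentSystem (minProj_rel (n := n)) hn
  rw [ofEnveloping, UniversalEnvelopingAlgebra.lift_ι_apply, ← dProj_H, dLift_dProj]
  rcases hv with ⟨h1, h2, rfl⟩ | ⟨h1, h2, rfl⟩
  · rw [freeLift_H (by unfold ValidH; simp; omega)]
    exact S.loopCoroot_zero ⟨i, h1, h2⟩
  · rw [freeLift_H (Or.inl ⟨h1, h2⟩)]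
    refine (S.loopCoroot_one ⟨i, by omega, by omega⟩).trans ?_
    rw [minProj_h, foldNode, if_neg (by simp; omega), if_neg (by simp; omega)]

/-- The homomorphism from the free associative algebra to `U(D(2n))`. -/
noncomputable def minFreeLift (n : ℕ) : MinFree n →ₐ[ℂ] UniversalEnvelopingAlgebra ℂ (D n) :=
  FreeAlgebra.lift ℂ fun
    | .h i r _ => UniversalEnvelopingAlgebra.ι ℂ (D.H n i r)
    | .x e i r _ => UniversalEnvelopingAlgebra.ι ℂ (D.X n e i r)

/-- The homomorphism from the free Lie algebra to `U(D(2n))`. -/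
noncomputable def freeToEnveloping (n : ℕ) :
    DFree n →ₗ⁅ℂ⁆ UniversalEnvelopingAlgebra ℂ (D n) :=
  (UniversalEnvelopingAlgebra.ι ℂ).comp (dProj n)

theorem freeToEnveloping_rel {a b : DFree n} (hab : DRel n a b) :
    freeToEnveloping n a = freeToEnveloping n b :=
  congrArg (UniversalEnvelopingAlgebra.ι ℂ) (dProj_rel hab)

theorem minFreeLift_h {i : ℤ} {r : ℕ} (hv : ValidMinH n i r) :
    minFreeLift n (MinFree.h n i r) = freeToEnveloping n (DFree.H n i r) := by
  rw [MinFree.h, dif_pos hv, minFreeLift, FreeAlgebra.lift_ι_apply]; rfl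

theorem minFreeLift_x (e : Sgn) {i : ℤ} {r : ℕ} (hv : ValidMinX n i r) :
    minFreeLift n (MinFree.x n e i r) = freeToEnveloping n (DFree.X n e i r) := by
  rw [MinFree.x, dif_pos hv, minFreeLift, FreeAlgebra.lift_ι_apply]; rfl

theorem minFreeLift_x_zero (e : Sgn) (i : ℤ) :
    minFreeLift n (MinFree.x n e i 0) = freeToEnveloping n (DFree.X n e i 0) := by
  by_cases hi : 0 ≤ i ∧ i ≤ (n : ℤ)
  · exact minFreeLift_x e ⟨hi.1, hi.2, Or.inl rfl⟩
  · rw [DFree.X, dif_neg (fun H => H.elim hi (fun H => by simp at H)), MinFree.x,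
      dif_neg (fun H => hi ⟨H.1, H.2.1⟩), map_zero, map_zero]

theorem ValidMinH.validH {i : ℤ} {r : ℕ} (hv : ValidMinH n i r) : ValidH n i r := by
  rcases hv with ⟨h1, h2, rfl⟩ | ⟨h1, h2, rfl⟩
  · by_cases h : 1 ≤ i ∧ i ≤ (n : ℤ) - 1
    · exact Or.inl h
    · exact Or.inr ⟨by omega, by decide⟩
  · exact Or.inl ⟨h1, h2⟩

/-- The relations of `D̃(2n)` follow from those of `D(2n)`. -/
theorem minRel_of_dRel (hn : 4 ≤ n) {L : Type} [LieRing L] [LieAlgebra ℂ L]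
    {q : MinFree n →ₗ⁅ℂ⁆ L} {f : DFree n →ₗ⁅ℂ⁆ L} (hf : ∀ a b, DRel n a b → f a = f b)
    (hH : ∀ i r, ValidMinH n i r → q (MinFree.h n i r) = f (DFree.H n i r))
    (hX : ∀ e i r, ValidMinX n i r → q (MinFree.x n e i r) = f (DFree.X n e i r))
    (hX0 : ∀ e i, q (MinFree.x n e i 0) = f (DFree.X n e i 0)) {a b : MinFree n}
    (hab : MinRel n a b) : q a = q b := by
  have hX1 : ∀ e {i : ℤ}, (0 ≤ i ∧ i ≤ (n : ℤ)) →
      q (MinFree.x n e i 1) = f (DFree.X n e i 1) :=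
    fun e i hi => hX e i 1 ⟨hi.1, hi.2, Or.inr rfl⟩
  have hcoroot : ∀ {i : ℤ} (r s : ℕ), 0 ≤ i ∧ i ≤ (n : ℤ) →
      ⁅f (DFree.X n .pos i r), f (DFree.X n .neg i s)⁆ = f (DFree.coroot n i (r + s)) :=
    fun r s hi => by rw [← LieHom.map_lie, hf _ _ (DRel.xx_same _ r s hi)]
  have g0 : (0 : ℤ) ≤ 0 ∧ (0 : ℤ) ≤ (n : ℤ) := by omega
  have g1 : (0 : ℤ) ≤ 1 ∧ (1 : ℤ) ≤ (n : ℤ) := by omega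
  have gM : (0 : ℤ) ≤ (n : ℤ) - 1 ∧ (n : ℤ) - 1 ≤ (n : ℤ) := by omega
  have gN : (0 : ℤ) ≤ (n : ℤ) ∧ (n : ℤ) ≤ (n : ℤ) := by omega
  cases hab with
  | hh i j r s hi hj =>
    rw [LieHom.map_lie, hH _ _ hi, hH _ _ hj, ← LieHom.map_lie,
      hf _ _ (DRel.hh i j r s hi.validH hj.validH), map_zero, map_zero]
  | hx e i j r hi hj =>
    have hr : r = 0 ∨ r = 1 := hi.imp (fun H => H.2.2) (fun H => H.2.2)
    rw [LieHom.map_lie, hH _ _ hi, hX0, ← LieHom.map_lie,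
      hf _ _ (DRel.hx e i j r 0 hi.validH hj), map_zsmul, map_zsmul, hX e j r ⟨hj.1, hj.2, hr⟩,
      add_zero]
  | xx_same i hi =>
    rw [LieHom.map_lie, hX0, hX0, hcoroot 0 0 hi, hH _ _ (Or.inl ⟨hi.1, hi.2, rfl⟩),
      DFree.coroot, if_pos (by decide)]
  | xx_diff i j hi hj hij =>
    rw [LieHom.map_lie, hX0, hX0, ← LieHom.map_lie, map_zero]
    have hneg : ∀ e k, f (DFree.negOdd n e k (0 + 0)) = 0 := fun e k => by
      rw [DFree.negOdd, if_neg (by decide), map_zero]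
    by_cases hfk : IsFork n i j
    -- On a fork the right-hand side is the additional generator, absent in the even degree 0.
    · rcases hfk with ⟨rfl, rfl⟩ | ⟨rfl, rfl⟩ | ⟨rfl, rfl⟩ | ⟨rfl, rfl⟩
      · rw [hf _ _ (DRel.xx_zero_one 0 0), hneg]
      · rw [hf _ _ (DRel.xx_one_zero 0 0), hneg]
      · rw [hf _ _ (DRel.xx_pred_last 0 0), hneg]
      · rw [hf _ _ (DRel.xx_last_pred 0 0), hneg]
    · rw [hf _ _ (DRel.xx_diff i j 0 0 hi hj hij hfk), map_zero]
  | xx_one_mid i hi =>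
    have hi' : 0 ≤ i ∧ i ≤ (n : ℤ) := by omega
    rw [LieHom.map_lie, hX0, hX1 _ hi', hcoroot 1 0 hi', hH _ _ (Or.inr ⟨hi.1, hi.2, rfl⟩),
      DFree.coroot, if_neg (by decide), if_neg (by omega), if_neg (by omega)]
  | xx_one_last =>
    rw [LieHom.map_lie, hX0, hX1 _ gN, hcoroot 1 0 gN,
      hH _ _ (Or.inr ⟨by omega, by omega, rfl⟩), DFree.coroot, if_neg (by decide),
      if_neg (by omega), if_pos rfl]
  | xx_one_zero =>
    rw [LieHom.map_lie, hX0, hX1 _ g0, hcoroot 1 0 g0,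
      hH _ _ (Or.inr ⟨by omega, by omega, rfl⟩), DFree.coroot, if_neg (by decide), if_pos rfl]
  | same_node e i hi =>
    rw [LieHom.map_lie, hX0, hX1 _ hi, ← LieHom.map_lie,
      hf _ _ (DRel.same_node e i 1 0 (Or.inl hi) (Or.inl hi)), map_zero, map_zero]
  | serre_two e i j hi hj ha =>
    have hij : i ≠ j := by
      rintro rfl
      rw [cartan, if_pos (by decide), cartanEven, if_pos rfl] at ha
      omega
    rw [LieHom.map_lie, hX0, hX0, ← LieHom.map_lie,
      hf _ _ (DRel.serre_two e i j 0 0 hi hj hij ha (fun _ => by decide)), map_zero, map_zero]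
  | serre_three e i j hi hj ha =>
    rw [LieHom.map_lie, LieHom.map_lie, hX0, hX0, ← LieHom.map_lie, ← LieHom.map_lie,
      hf _ _ (DRel.serre_three e i j 0 0 0 hi hj ha), map_zero, map_zero]
  | fork_last e =>
    -- The inner bracket is H_{n-1,2}, which acts on node n by the even entry a_{n-1,n} = 0.
    have hv : ValidH n ((n : ℤ) - 1) 2 := Or.inl (by omega)
    rw [LieHom.map_lie, LieHom.map_lie, hX0, hX1 _ gM, hX1 _ gM, hcoroot 1 1 gM, DFree.coroot,
      if_pos (by decide), ← LieHom.map_lie, hf _ _ (DRel.hx e _ _ 2 0 hv gN), cartan,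
      if_pos (by decide), IsFork.cartanEven_eq hn (Or.inr (Or.inr (Or.inl ⟨rfl, rfl⟩))), mul_zero,
      zero_smul, map_zero, map_zero]
  | fork_zero e =>
    -- Here the inner bracket is H_{0,2}, which exists because 2 is even, and a_{0,1} = 0.
    have hv : ValidH n 0 2 := Or.inr ⟨Or.inl rfl, by decide⟩
    rw [LieHom.map_lie, LieHom.map_lie, hX0, hX1 _ g0, hX1 _ g0, hcoroot 1 1 g0, DFree.coroot,
      if_pos (by decide), ← LieHom.map_lie, hf _ _ (DRel.hx e _ _ 2 0 hv g1), cartan,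
      if_pos (by decide), IsFork.cartanEven_eq hn (Or.inl ⟨rfl, rfl⟩), mul_zero,
      zero_smul, map_zero, map_zero]
  | loop u =>
    have h1 := hf _ _ (DRel.loop u)
    rw [map_sub, LieHom.map_lie, LieHom.map_lie, LieHom.map_lie, LieHom.map_lie, map_loopCartan,
      map_zero] at h1
    rw [map_sub, LieHom.map_lie, LieHom.map_lie, LieHom.map_lie, LieHom.map_lie, map_loopCartan,
      map_zero]
    simp only [hX0, hX1 _ g1]
    exact h1

theorem minFreeLift_rel (hn : 4 ≤ n) {a b : MinFree n} (hab : MinRel n a b) :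
    minFreeLift n a = minFreeLift n b :=
  minRel_of_dRel (q := (minFreeLift n).toLieHom) (f := freeToEnveloping n) hn
    (fun _ _ => freeToEnveloping_rel) (fun _ _ => minFreeLift_h)
    (fun e _ _ => minFreeLift_x e) minFreeLift_x_zero hab

/-- The homomorphism from `D̃(2n)` to `U(D(2n))`. -/
noncomputable def toEnveloping (hn : 4 ≤ n) : DMin n →ₐ[ℂ] UniversalEnvelopingAlgebra ℂ (D n) :=
  RingQuot.liftAlgHom ℂ ⟨minFreeLift n, fun _ _ => minFreeLift_rel hn⟩

theorem toEnveloping_h (hn : 4 ≤ n) {i : ℤ} {r : ℕ} (hv : ValidMinH n i r) :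
    toEnveloping hn (DMin.h n i r) = UniversalEnvelopingAlgebra.ι ℂ (D.H n i r) := by
  rw [toEnveloping, DMin.h, RingQuot.liftAlgHom_mkAlgHom_apply, minFreeLift_h hv]; rfl

theorem toEnveloping_x (hn : 4 ≤ n) (e : Sgn) {i : ℤ} {r : ℕ} (hv : ValidMinX n i r) :
    toEnveloping hn (DMin.x n e i r) = UniversalEnvelopingAlgebra.ι ℂ (D.X n e i r) := by
  rw [toEnveloping, DMin.x, RingQuot.liftAlgHom_mkAlgHom_apply, minFreeLift_x e hv]; rfl

/-! ### The two homomorphisms are mutually inverse -/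

/-- The composite fixes the low-degree elements, and these generate D(2n); the higher generators
need no separate check. -/
theorem toEnveloping_comp_ofEnveloping (hn : 4 ≤ n) :
    (toEnveloping hn).comp (ofEnveloping hn) =
      AlgHom.id ℂ (UniversalEnvelopingAlgebra ℂ (D n)) := by
  refine UniversalEnvelopingAlgebra.hom_ext _ (D_hom_ext hn (fun i r hv => ?_) fun e i r hv => ?_)
  · change toEnveloping hn (ofEnveloping hn (UniversalEnvelopingAlgebra.ι ℂ (D.H n i r))) = _
    rw [ofEnveloping_H hn hv, toEnveloping_h hn hv]; rfl
  · change toEnveloping hn (ofEnveloping hn (UniversalEnvelopingAlgebra.ι ℂ (D.X n e i r))) = _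
    rw [ofEnveloping_X hn e hv, toEnveloping_x hn e hv]; rfl

theorem ofEnveloping_comp_toEnveloping (hn : 4 ≤ n) :
    (ofEnveloping hn).comp (toEnveloping hn) = AlgHom.id ℂ (DMin n) := by
  refine RingQuot.ringQuot_ext' ℂ _ _ (FreeAlgebra.hom_ext (funext fun g => ?_))
  cases g with
  | h i r hv =>
    have := toEnveloping_h hn hv
    have h2 := ofEnveloping_H hn hv
    rw [← this, DMin.h, MinFree.h, dif_pos hv] at h2
    exact h2
  | x e i r hv =>
    have := toEnveloping_x hn e hv
    have h2 := ofEnveloping_X hn e hv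
    rw [← this, DMin.x, MinFree.x, dif_pos hv] at h2
    exact h2

end TwistedD

theorem mainTheorem3 (n : ℕ) (hn : 4 ≤ n) :
    (∃ e : TwistedD.DMin n ≃ₐ[ℂ] UniversalEnvelopingAlgebra ℂ (TwistedD.D n),
      (∀ (i : ℤ) (r : ℕ), TwistedD.ValidMinH n i r →
        e (TwistedD.DMin.h n i r) = UniversalEnvelopingAlgebra.ι ℂ (TwistedD.D.H n i r)) ∧
      (∀ (s : TwistedD.Sgn) (i : ℤ) (r : ℕ), TwistedD.ValidMinX n i r →
        e (TwistedD.DMin.x n s i r) = UniversalEnvelopingAlgebra.ι ℂ (TwistedD.D.X n s i r))) ∧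
    LieSubalgebra.lieSpan ℂ (TwistedD.D n)
      ({y | ∃ (i : ℤ) (r : ℕ), TwistedD.ValidMinH n i r ∧ y = TwistedD.D.H n i r} ∪
        {y | ∃ (s : TwistedD.Sgn) (i : ℤ) (r : ℕ), TwistedD.ValidMinX n i r ∧
          y = TwistedD.D.X n s i r}) = ⊤ :=
  ⟨⟨AlgEquiv.ofAlgHom (TwistedD.toEnveloping hn) (TwistedD.ofEnveloping hn)
      (TwistedD.toEnveloping_comp_ofEnveloping hn) (TwistedD.ofEnveloping_comp_toEnveloping hn),
    fun _ _ hv => TwistedD.toEnveloping_h hn hv, fun e _ _ hv => TwistedD.toEnveloping_x hn e hv⟩,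
    TwistedD.lieSpan_lowGenerators hn⟩
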